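/- **Loop values.** A labelled loop with $P$ points is a cyclic sequence $(i_1\,i_2\cdots i_P)$ of distinct positive integers (a single-cycle permutation $\sigma$ of its label set); the label $i$ carries a real variable $x_i$, and the points are ordered on a chain as their labels; write $\nabla_i=\partial/\partial x_i$. Fix $n_a\in\mathbb R$. The *stationarity conditions* for a family of polynomials $[\sigma]$, where $[\sigma]$ depends only on the variables of the points of $\sigma$, are: (locality) $\nabla_i^2[\sigma]=0$ for every $i$; $[(i)]=n_a+x_i$; for $P\ge 2$, $[\sigma]$ vanishes at $x_{\min}=0$ and at $x_{\max}=1$; and, for neighbouring labels $a<b$ of $\sigma=(a\,u\,b\,v)$ and its conjugate $\sigma'=(b\,u\,a\,v)$ by the transposition of $a$ and $b$, $$[\sigma]\big|_{x_a=x_b}=[\sigma']\big|_{x_a=x_b},\qquad (\nabla_a-\nabla_b)([\sigma]+[\sigma'])\big|_{x_a=x_b}=2\,\nabla_a[(a\,u)]\,\nabla_b[(b\,v)].$$ The *loop values* $[\sigma]$ are the polynomials defined recursively by $[(i)]=n_a+x_i$ and, for a loop with $P\ge2$ points labelled $1,\dots,P$ (for other label sets after order-preserving relabelling), $$[\sigma]=\sum_{j=1}^{P-2}x_1\cdots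 x_j\,[\sigma]^o_{j+1}+x_1\cdots x_{P-1}(1-x_P)[\sigma]^o_P,\qquad [\sigma]^o_{j+1}=\nabla_{j+1}\cdots\nabla_1\sum_{k=1}^{j}[(\sigma_{k,j})_k^-]\,[(\sigma_{k,j})_k^+],$$ where $\sigma_{k,j}$ is the conjugate of $\sigma$ by $\tau_{k+1}\cdots\tau_j$, $\tau_i=(i\;i{+}1)$, and $\rho_k^-\ni k$, $\rho_k^+\ni k+1$ are the two cycles of $\tau_k\rho$. **Deformations.** Let $\mu$ be a permutation of $\{1,\dots,|\mu|\}$, and let $\mu_n\circ\omega_P$ be the loop $(1,\dots,n-1,\mu(1)+n-1,\dots,\mu(|\mu|)+n-1,n+|\mu|,\dots,P)$; $\omega_P=(1\,2\cdots P)$. Put $y_l=x_{P-l}$ and $$C^{\mu_n}_{P;k}=\nabla_1\cdots\nabla_{P-k}[\mu_n\circ\omega_P],\qquad S^{\mu_n}_{P;k}=\nabla_1\cdots\nabla_{P-k-1}[\mu_n\circ\omega_P]\big|_{x_{P-k}=0},$$ which are polynomials in $y_0,\dots,y_{k-1}$; write $C_{P;k}$ for $\mu$ trivial. Define formal power series $$\mathcal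 C_k(z)=\sum_{N\ge0}C_{N+k+1;k}z^N,\qquad \mathcal D^{(\mu;q)}_k(z)=\sum_{N\ge0}C^{\mu_{q+N}}_{N+k+1;k}z^N,\qquad \mathcal S^{(\mu;q)}_k(z)=\sum_{N\ge0}S^{\mu_{q+N+1}}_{N+k+2;k}z^N,$$ $$\widehat{\mathcal D}^\mu_{k';p'}(z)=\sum_{N\ge0}C^{\mu_{N+1}}_{N+k'+|\mu|;k'+p'}z^N,\qquad \widehat{\mathcal S}^\mu_{k';p'}(z)=\sum_{N\ge0}S^{\mu_{N+1}}_{N+k'+|\mu|;k'+p'}z^N,$$ where the $N=0$ term of $\widehat{\mathcal S}^\mu_{k';|\mu|-1}$ is $0$ by convention. **Extractions.** Let $\omega^\ell_M$ be the cycle $(\ell,\ell+1,\dots,M)$. For $1\le M\le|\mu|$, $\mu^{M]}$ and $\mu^{[M}$ are the restrictions of $\mu$ to $[1,\mu^{-1}(M)-1]$ and to $[\mu^{-1}(M)+1,|\mu|]$. For $m<M$ let $a<b$ be the two numbers $\mu^{-1}(m),\mu^{-1}(M)$ in increasing order; $\mu^{[m,M]}$ is the restriction of $\mu$ to $[a,b-1]$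 and $\mu^{m][M}$ its restriction to the complement of $[a,b-1]$ in $[1,|\mu|]$. Set $\mu^{M]}_\varpi=\omega^1_M\mu^{M]}$, $\mu^{[M}_\varpi=\omega^1_M\mu^{[M}$, $\mu^{[m,M]}_\varpi=\omega^{m+1}_M\mu^{[m,M]}$, $\mu^{m][M}_\varpi=\omega^{m+1}_M\mu^{m][M}$. Each is identified, by order-preserving relabelling of its domain and of its image, with a permutation of $\{1,\dots,\text{its length}\}$. Let $k^{M]},k^{[M},k^{[m,M]},k^{m][M}$ be the numbers of elements of $[M+1,|\mu|]$ in the images of the four extractions. In the generating functions $\widehat{\mathcal D}^{\nu}_{\kappa;k^\nu}$ of the extractions below ($\kappa\in\{0,k'\}$, $k^\nu$ the corresponding number), the variables $y_0,\dots,y_{\kappa-1}$ are unchanged, while $y_{\kappa+i}$, $0\le i<k^\nu$, stands for $y_{k'+|\mu|-j}$, where $j$ is the $(i+1)$-st largest element of $[M+1,|\mu|]$ in the image of $\nu$. **Proposition.** (0) Every family satisfying the stationarity conditions coincides with the loop values. For every $\mu$ with $|\mu|\ge1$: (i) For all $k'\ge0$, $0\le p'\le|\mu|-1$ and $M=|\mu|-p'$,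 $$\widehat{\mathcal D}^\mu_{k';p'+1}(z)=\widehat{\mathcal S}^\mu_{k';p'}(z)+y_{k'+p'}\widehat{\mathcal D}^\mu_{k';p'}(z)$$ (if $k'=0$ and $|\mu|=1$, the constant $n_a$ of the one-point function has to be added on the right), and $$\widehat{\mathcal S}^\mu_{k';p'}(z)=z^{-1}\Big(\widehat{\mathcal D}^{\mu^{M]}_\varpi}_{0;k^{M]}}(z)-\widehat{\mathcal D}^{\mu^{M]}_\varpi}_{0;k^{M]}}(0)\Big)\Big(\widehat{\mathcal D}^{\mu^{[M}_\varpi}_{k';k^{[M}}(z)-\widehat{\mathcal D}^{\mu^{[M}_\varpi}_{k';k^{[M}}(0)\Big)+\sum_{m=1}^{M-1}\widehat{\mathcal D}^{\mu^{[m,M]}_\varpi}_{0;k^{[m,M]}}(0)\,\widehat{\mathcal D}^{\mu^{m][M}_\varpi}_{k';k^{m][M}}(z),$$ with $k^{[M}+k^{M]}=p'$ and $k^{m][M}+k^{[m,M]}=p'$ for $1\le m\le M-1$. (ii) For all $k'\ge0$, $\widehat{\mathcal D}^\mu_{k';0}(z)=\big[z^{1-|\mu|}\mathcal C_{k'}(z)\big]_+$,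 where $[\cdot]_+$ is the part of nonnegative degrees of a Laurent series. (iii) For all $k\ge0$, $\mathcal D^{(\mu;1)}_{k+|\mu|}(z)=\widehat{\mathcal D}^\mu_{k+1;|\mu|-1}(z)$ and $\mathcal S^{(\mu;1)}_{k+|\mu|}(z)=z^{-1}\big(\widehat{\mathcal S}^\mu_{k+1;|\mu|-1}(z)-\widehat{\mathcal S}^\mu_{k+1;|\mu|-1}(0)\big)$. -/

import Mathlib

namespace QSSEP

/-! ### Labelled loops

A labelled loop is a cyclic sequence `(i₁ i₂ ⋯ i_P)` of pairwise distinct labels, the labels being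
ordered as the points on the chain.  It is represented by a list without repetition, read up to
rotation (an element of `Cycle ℕ`).  To the label `i` corresponds the variable `X i` of
`MvPolynomial ℕ ℝ`, the position `x_i` on the chain. -/

/-- The strand of the loop `w` from `a` (included) to `b` (excluded).  Cutting the loop of `σ` at
`a` and `b` gives the loops `a → σ a → ⋯ → σ⁻¹ b → a` and `b → σ b → ⋯ → σ⁻¹ a → b`. -/
def strand (w : List ℕ) (a b : ℕ) : List ℕ :=
  (w.rotate (w.idxOf a)).takeWhile (fun c => c ≠ b)

/-- The stationarity conditions for a family `E` of polynomials indexed by the labelled loops,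
in the local (harmonic in each variable) form, with the normalisation `Δn = 1`; `na` is the
density at the left end of the chain. -/
structure IsStationary (na : ℝ) (E : Cycle ℕ → MvPolynomial ℕ ℝ) : Prop where
  /-- `[σ]` depends on the positions of its own points only. -/
  vars_subset : ∀ w : List ℕ, w ≠ [] → w.Nodup → (E (w : Cycle ℕ)).vars ⊆ w.toFinset
  /-- Locality: `Δ_{x_i} [σ] = 0` for each `i`. -/
  harmonic : ∀ w : List ℕ, w ≠ [] → w.Nodup → ∀ i : ℕ,
    MvPolynomial.pderiv i (MvPolynomial.pderiv i (E (w : Cycle ℕ))) = 0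
  /-- The one-point loop: `[(i)] = n_a + x_i`. -/
  one_point : ∀ i : ℕ, E (([i] : List ℕ) : Cycle ℕ) = MvPolynomial.C na + MvPolynomial.X i
  /-- Boundary condition at the left end. -/
  left_boundary : ∀ w : List ℕ, 2 ≤ w.length → w.Nodup → ∀ a ∈ w, (∀ c ∈ w, a ≤ c) →
    MvPolynomial.aeval (Function.update MvPolynomial.X a (0 : MvPolynomial ℕ ℝ))
      (E (w : Cycle ℕ)) = 0
  /-- Boundary condition at the right end. -/
  right_boundary : ∀ w : List ℕ, 2 ≤ w.length → w.Nodup → ∀ b ∈ w, (∀ c ∈ w, c ≤ b) →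
    MvPolynomial.aeval (Function.update MvPolynomial.X b (1 : MvPolynomial ℕ ℝ))
      (E (w : Cycle ℕ)) = 0
  /-- Continuity at `x_a = x_b` for neighbouring points `a < b`: the loop `(a u b v)` and its
  conjugate `(b u a v)` by the transposition of `a` and `b`. -/
  continuity : ∀ (a b : ℕ) (u v : List ℕ), (a :: u ++ b :: v).Nodup → a < b →
    (∀ c ∈ u ++ v, c < a ∨ b < c) →
    MvPolynomial.aeval (Function.update MvPolynomial.X a (MvPolynomial.X b : MvPolynomial ℕ ℝ))
        (E ((a :: u ++ b :: v : List ℕ) : Cycle ℕ)) =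
      MvPolynomial.aeval (Function.update MvPolynomial.X a (MvPolynomial.X b : MvPolynomial ℕ ℝ))
        (E ((b :: u ++ a :: v : List ℕ) : Cycle ℕ))
  /-- The Neumann-like gluing condition at `x_a = x_b` for neighbouring points `a < b`, where
  `(a u)` and `(b v)` are the two loops obtained by cutting `(a u b v)` at `a` and `b`. -/
  gluing : ∀ (a b : ℕ) (u v : List ℕ), (a :: u ++ b :: v).Nodup → a < b →
    (∀ c ∈ u ++ v, c < a ∨ b < c) →
    MvPolynomial.aeval (Function.update MvPolynomial.X a (MvPolynomial.X b : MvPolynomial ℕ ℝ))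
        (MvPolynomial.pderiv a (E ((a :: u ++ b :: v : List ℕ) : Cycle ℕ)
            + E ((b :: u ++ a :: v : List ℕ) : Cycle ℕ))
          - MvPolynomial.pderiv b (E ((a :: u ++ b :: v : List ℕ) : Cycle ℕ)
            + E ((b :: u ++ a :: v : List ℕ) : Cycle ℕ))) =
      2 * MvPolynomial.pderiv a (E ((a :: u : List ℕ) : Cycle ℕ))
        * MvPolynomial.pderiv b (E ((b :: v : List ℕ) : Cycle ℕ))

/-! ### The loop expectation values -/

/-- Successive derivatives with respect to the variables listed in `l`. -/
noncomputable def derivs (l : List ℕ) (p : MvPolynomial ℕ ℝ) : MvPolynomial ℕ ℝ :=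
  l.foldl (fun q i => MvPolynomial.pderiv i q) p

/-- The `i`-th label (`i = 1, …, P`) of the loop `w` in the order of the chain. -/
def label (w : List ℕ) (i : ℕ) : ℕ :=
  (w.insertionSort (· ≤ ·)).getD (i - 1) 0

/-- `τ_{k+1} ⋯ τ_j ∘ w`, where `τ_i` is the transposition of the `i`-th and `(i+1)`-st labels
of `w`. -/
def slide (w : List ℕ) (k j : ℕ) : List ℕ :=
  w.map (((List.range' (k + 1) (j - k)).map
    (fun i => Equiv.swap (label w i) (label w (i + 1)))).prod : Equiv.Perm ℕ)

/-- The hole coefficient `[σ]^o_{j+1}`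
`= ∇_{j+1} ⋯ ∇_1 ∑_{k=1}^j [(τ_{k+1} ⋯ τ_j ∘ σ)_k^-] [(τ_{k+1} ⋯ τ_j ∘ σ)_k^+]`,
computed from given values `F` on the smaller loops. -/
noncomputable def hole (F : List ℕ → MvPolynomial ℕ ℝ) (w : List ℕ) (j : ℕ) :
    MvPolynomial ℕ ℝ :=
  derivs ((List.range' 1 (j + 1)).map (label w))
    (∑ k ∈ Finset.Icc 1 j,
      F (strand (slide w k j) (label w k) (label w (k + 1))) *
        F (strand (slide w k j) (label w (k + 1)) (label w k)))

/-- The loop expectation values of the loops with at most `n` points (first argument after `na`: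
the bound `n`, on which the recursion runs). -/
noncomputable def loopValueAux (na : ℝ) : ℕ → List ℕ → MvPolynomial ℕ ℝ
  | 0, _ => 0
  | n + 1, w =>
    if w.length = 1 then MvPolynomial.C na + MvPolynomial.X (label w 1)
    else
      (∑ j ∈ Finset.Icc 1 (w.length - 2),
          (∏ i ∈ Finset.Icc 1 j, MvPolynomial.X (label w i)) * hole (loopValueAux na n) w j)
        + (∏ i ∈ Finset.Icc 1 (w.length - 1), MvPolynomial.X (label w i))
            * (1 - MvPolynomial.X (label w w.length))
            * hole (loopValueAux na n) w (w.length - 1)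

/-- The loop expectation value `[σ]` of the labelled loop `w`, with `Δn = 1`:
`[(i)] = n_a + x_i` and, for `P ≥ 2` points `x_1 < ⋯ < x_P`,
`[σ] = ∑_{j=1}^{P-2} x_1 ⋯ x_j [σ]^o_{j+1} + x_1 ⋯ x_{P-1} (1 - x_P) [σ]^o_P`. -/
noncomputable def loopValue (na : ℝ) (w : List ℕ) : MvPolynomial ℕ ℝ :=
  loopValueAux na w.length w

/-! ### Deformations

A deformation `μ ∈ 𝕊_{|μ|}` is given in one-line notation, as the list `[μ(1), …, μ(|μ|)]`, so that
`|μ|` is `μ.length` and `μ⁻¹(M)` is `μ.idxOf M + 1`. -/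

/-- `μ` is the one-line notation of a permutation of `{1, …, |μ|}`. -/
def IsDeformation (μ : List ℕ) : Prop :=
  μ.Perm (List.range' 1 μ.length)

/-- The loop of `μ_n ∘ ω_P`:
`(1, …, n-1, μ_n(n), …, μ_n(n+|μ|-1), n+|μ|, …, P)` with `μ_n(j+n-1) = μ(j)+n-1`. -/
def deformedLoop (μ : List ℕ) (n P : ℕ) : List ℕ :=
  List.range' 1 (n - 1) ++ μ.map (fun v => v + n - 1)
    ++ List.range' (n + μ.length) (P + 1 - (n + μ.length))

/-- The cycle `ω^ℓ_M = (ℓ, ℓ+1, …, M)`. -/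
def omegaCycle (l M : ℕ) : Equiv.Perm ℕ :=
  (List.range' l (M + 1 - l)).formPerm

/-- The order preserving identification of a list of distinct integers (the images of a truncation)
with the one-line notation of a permutation: each entry is replaced by its rank. -/
def standardize (e : List ℕ) : List ℕ :=
  e.map (fun v => (e.filter (fun c => c ≤ v)).length)

/-- The images of `μ_ϖ^{M]} = ω^1_M μ^{M]}`. -/
def extLeft (μ : List ℕ) (M : ℕ) : List ℕ :=
  (μ.take (μ.idxOf M)).map (omegaCycle 1 M)

/-- The images of `μ_ϖ^{[M} = ω^1_M μ^{[M}`. -/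
def extRight (μ : List ℕ) (M : ℕ) : List ℕ :=
  (μ.drop (μ.idxOf M + 1)).map (omegaCycle 1 M)

/-- The images of `μ_ϖ^{[m,M]} = ω^{m+1}_M μ^{[m,M]}`: the part of `μ` from the first (included) to
the second (excluded) of the two places where the values `m` and `M` are taken. -/
def extBetween (μ : List ℕ) (m M : ℕ) : List ℕ :=
  ((μ.drop (min (μ.idxOf m) (μ.idxOf M))).take
    (max (μ.idxOf m) (μ.idxOf M) - min (μ.idxOf m) (μ.idxOf M))).map (omegaCycle (m + 1) M)

/-- The images of `μ_ϖ^{m][M} = ω^{m+1}_M μ^{m][M}`, `μ^{m][M}` being complementary to `μ^{[m,M]}`. -/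
def extOutside (μ : List ℕ) (m M : ℕ) : List ℕ :=
  (μ.take (min (μ.idxOf m) (μ.idxOf M)) ++ μ.drop (max (μ.idxOf m) (μ.idxOf M))).map
    (omegaCycle (m + 1) M)

/-- The images of an extraction that lie in `[M+1, s]`, in decreasing order. -/
def floating (e : List ℕ) (M s : ℕ) : List ℕ :=
  (e.filter (fun j => M + 1 ≤ j ∧ j ≤ s)).insertionSort (· ≥ ·)

/-! ### Generating functions

From here on the variables of the polynomials are the `y_l = x_{P-l}`. -/

/-- `C^{μ_n}_{P;k} = ∇_1 ⋯ ∇_{P-k} [μ_n ∘ ω_P]`, as a polynomial in `y_l = x_{P-l}`. -/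
noncomputable def coefC (na : ℝ) (μ : List ℕ) (n P k : ℕ) : MvPolynomial ℕ ℝ :=
  MvPolynomial.rename (fun j => P - j)
    (derivs (List.range' 1 (P - k)) (loopValue na (deformedLoop μ n P)))

/-- `S^{μ_n}_{P;k} = ∇_1 ⋯ ∇_{P-k-1} [μ_n ∘ ω_P]` at `x_{P-k} = 0`, as a polynomial in
`y_l = x_{P-l}`. -/
noncomputable def coefS (na : ℝ) (μ : List ℕ) (n P k : ℕ) : MvPolynomial ℕ ℝ :=
  MvPolynomial.rename (fun j => P - j)
    (MvPolynomial.aeval (Function.update MvPolynomial.X (P - k) (0 : MvPolynomial ℕ ℝ))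
      (derivs (List.range' 1 (P - k - 1)) (loopValue na (deformedLoop μ n P))))

/-- `𝒞_k(z) = ∑_N C_{N+k+1;k} z^N`, for the regular loops `ω_P = (1 2 ⋯ P)`. -/
noncomputable def genC (na : ℝ) (k : ℕ) : PowerSeries (MvPolynomial ℕ ℝ) :=
  PowerSeries.mk fun N =>
    MvPolynomial.rename (fun j => N + k + 1 - j)
      (derivs (List.range' 1 (N + 1)) (loopValue na (List.range' 1 (N + k + 1))))

/-- `𝒟_k^{(μ;q)}(z) = ∑_N C^{μ_{q+N}}_{N+k+1;k} z^N`. -/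
noncomputable def genD (na : ℝ) (μ : List ℕ) (q k : ℕ) : PowerSeries (MvPolynomial ℕ ℝ) :=
  PowerSeries.mk fun N => coefC na μ (q + N) (N + k + 1) k

/-- `𝒮_k^{(μ;q)}(z) = ∑_N S^{μ_{q+N+1}}_{N+k+2;k} z^N`. -/
noncomputable def genS (na : ℝ) (μ : List ℕ) (q k : ℕ) : PowerSeries (MvPolynomial ℕ ℝ) :=
  PowerSeries.mk fun N => coefS na μ (q + N + 1) (N + k + 2) k

/-- `D̂^μ_{k';p'}(z) = ∑_N C^{μ_{N+1}}_{N+k'+|μ|; k'+p'} z^N`. -/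
noncomputable def hatD (na : ℝ) (μ : List ℕ) (k' p' : ℕ) : PowerSeries (MvPolynomial ℕ ℝ) :=
  PowerSeries.mk fun N => coefC na μ (N + 1) (N + k' + μ.length) (k' + p')

/-- `Ŝ^μ_{k';p'}(z) = ∑_N S^{μ_{N+1}}_{N+k'+|μ|; k'+p'} z^N`; the term `N = 0` for `p' = |μ| - 1`,
in which there would be no derivative, is `0` by convention. -/
noncomputable def hatS (na : ℝ) (μ : List ℕ) (k' p' : ℕ) : PowerSeries (MvPolynomial ℕ ℝ) :=
  PowerSeries.mk fun N =>
    if N = 0 ∧ p' + 1 = μ.length then 0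
    else coefS na μ (N + 1) (N + k' + μ.length) (k' + p')

/-- The generating function `D̂^ν_{κ;p}` of an extraction `ν` (with list of images `e`) of a
deformation of length `s`, `p` being the number of images of `ν` in `[M+1, s]`, in its own floating
variables: `y_0, …, y_{κ-1}` are unchanged, and the floating variables inside `ν` are the
`y_{k'+s-j}` for the images `j` of `ν` in `[M+1, s]`, in the order of the chain. -/
noncomputable def hatDExt (na : ℝ) (s M k' : ℕ) (e : List ℕ) (κ : ℕ) :
    PowerSeries (MvPolynomial ℕ ℝ) :=
  PowerSeries.map
    (MvPolynomial.rename (R := ℝ) (fun i =>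
      if i < κ then i else k' + s - (floating e M s).getD (i - κ) 0)).toRingHom
    (hatD na (standardize e) κ (floating e M s).length)

/-- The part `[F]_+` with nonnegative degrees of a Laurent series. -/
def laurentPos {R : Type*} [CommRing R] (F : LaurentSeries R) : PowerSeries R :=
  PowerSeries.mk fun n => F.coeff (n : ℤ)

/-- The monomial `z^d`, as a Laurent series. -/
noncomputable def zPow (d : ℤ) : LaurentSeries (MvPolynomial ℕ ℝ) :=
  HahnSeries.single d 1

/-- `F(z) - F(0)`. -/
noncomputable def subConst (F : PowerSeries (MvPolynomial ℕ ℝ)) :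
    PowerSeries (MvPolynomial ℕ ℝ) :=
  F - PowerSeries.C (PowerSeries.constantCoeff F)

end QSSEP

namespace QSSEP

open MvPolynomial

/-! ### Partial derivatives and multiaffine polynomials -/

/-! The central object is `lowDeriv`, the derivative of a loop value along all labels below a
threshold. It does not see the relative order of the labels differentiated away: it is covariant
under every injective relabelling that respects the threshold and keeps the order of the labels at
or above it (`lowDeriv_map`). The conjugations by `τ_{k+1} ⋯ τ_j` in the recursive definition move
only such labels, so each hole coefficient is the plain sum `holeAt` over the cuts of the loop
itself (`GoodBelow.hole_eq_holeAt`). For at least two points the recursion then reads: the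
derivative along the labels below `b` equals `holeAt` at `b` plus `X b` times the derivative along
the labels up to `b` (`lowDeriv_eq_holeAt_add`).

Degree at most one in each variable and covariance are proved by a joint induction on the number of
points (`goodBelow`). Covariance passes through the expansion along the first hole, except when
every label is differentiated; then the value is a signed Catalan number depending only on the
length (`holeAt_eq_of_full`).

Uniqueness (0): a polynomial is recovered by expanding it in one variable after the other, that is,
from the derivatives along the labels below `b` at `X b = 0`, together with the derivative along all
labels. For a stationary family these are forced. At the smallest label the left boundary gives
zero. Continuity and gluing together replace the datum at `b` by the datum at the preceding label
`a` of the exchanged loop, plus one product of cut loops; iterating collects the sum over cuts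
(`IsStationary.atZero_derivs`). The right boundary fixes the full derivative.

For (i), the coefficients of `z^N` in `hatD` and `hatS` are `lowDeriv` and `holeAt` of the loop with
`N` points before the deformation, so the first identity is the one-step recursion at `b = N + M`.
For the second, a cut at a point `i ≤ N` leaves `N + 1 - i` and `i` low points outside the
truncations of the deformation, which is a Cauchy product without constant terms, shifted by `z⁻¹`;
a cut at `N + m` leaves all `N` initial points on one side. Covariance identifies each cut loop with
a standardized extraction (`coeff_hatDExt`); of the cycles `ω^ℓ_M` it only matters that they
preserve the labels up to `M` and fix the others. Part (ii) is covariance with the whole deformation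
differentiated away, and (iii) is a comparison of indices. -/

theorem pderiv_comm (i j : ℕ) (p : MvPolynomial ℕ ℝ) :
    pderiv i (pderiv j p) = pderiv j (pderiv i p) := by
  rcases eq_or_ne i j with rfl | h
  · rfl
  · ext m
    simp only [coeff_pderiv, Finsupp.add_apply, Finsupp.single_apply, if_neg h, if_neg h.symm,
      add_right_comm m]
    push_cast
    ring

theorem notMem_vars_of_pderiv_eq_zero {i : ℕ} {p : MvPolynomial ℕ ℝ} (h : pderiv i p = 0) :
    i ∉ p.vars := by
  rw [mem_vars_iff_mem_support]
  rintro ⟨m, hm, hi⟩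
  have h1 := congrArg (coeff (m - Finsupp.single i 1)) h
  have h2 : m - Finsupp.single i 1 + Finsupp.single i 1 = m := by
    apply tsub_add_cancel_of_le
    rw [Finsupp.single_le_iff]
    exact Nat.one_le_iff_ne_zero.mpr (Finsupp.mem_support_iff.mp hi)
  rw [coeff_pderiv, h2, coeff_zero] at h1
  rcases mul_eq_zero.mp h1 with h3 | h3
  · exact (mem_support_iff.mp hm) h3
  · exact absurd h3 (by positivity)

theorem aeval_eq_self_of_pderiv_eq_zero {i : ℕ} {p : MvPolynomial ℕ ℝ} (h : pderiv i p = 0)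
    (q : MvPolynomial ℕ ℝ) : aeval (Function.update X i q) p = p := by
  have hi := notMem_vars_of_pderiv_eq_zero h
  conv_rhs => rw [← aeval_X_left_apply (R := ℝ) p]
  refine eval₂Hom_congr' rfl (fun j hj _ => ?_) rfl
  rw [Function.update_of_ne]
  rintro rfl
  exact hi hj

/-- The value at `X i = 0` of a polynomial which is affine in `X i`. -/
noncomputable def atZero (i : ℕ) (p : MvPolynomial ℕ ℝ) : MvPolynomial ℕ ℝ :=
  p - X i * pderiv i p

theorem pderiv_atZero_self {i : ℕ} {p : MvPolynomial ℕ ℝ} (h : pderiv i (pderiv i p) = 0) :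
    pderiv i (atZero i p) = 0 := by
  simp [atZero, h]

theorem pderiv_atZero_of_ne {i j : ℕ} (hij : i ≠ j) (p : MvPolynomial ℕ ℝ) :
    pderiv j (atZero i p) = atZero i (pderiv j p) := by
  simp [atZero, pderiv_X_of_ne hij, pderiv_comm j i]

theorem aeval_update_eq {i : ℕ} {p : MvPolynomial ℕ ℝ} (h : pderiv i (pderiv i p) = 0)
    (q : MvPolynomial ℕ ℝ) :
    aeval (Function.update X i q) p = atZero i p + q * pderiv i p := by
  have h1 : p = atZero i p + X i * pderiv i p := by simp [atZero]
  conv_lhs => rw [h1]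
  rw [map_add, map_mul, aeval_eq_self_of_pderiv_eq_zero (pderiv_atZero_self h),
    aeval_eq_self_of_pderiv_eq_zero h, aeval_X, Function.update_self]

/-- Polynomials of degree at most one in each variable, in the variables of `S`. -/
def MultiAffine (S : Finset ℕ) (p : MvPolynomial ℕ ℝ) : Prop :=
  ∀ i, pderiv i (pderiv i p) = 0 ∧ (i ∉ S → pderiv i p = 0)

namespace MultiAffine

variable {S S' : Finset ℕ} {p q : MvPolynomial ℕ ℝ}

theorem vars_subset (h : MultiAffine S p) : p.vars ⊆ S := fun i hi => by
  by_contra hS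
  exact notMem_vars_of_pderiv_eq_zero ((h i).2 hS) hi

theorem mono (h : MultiAffine S p) (hS : S ⊆ S') : MultiAffine S' p :=
  fun i => ⟨(h i).1, fun hi => (h i).2 fun h' => hi (hS h')⟩

theorem const (r : ℝ) : MultiAffine S (C r) := fun i => by simp

theorem var {i : ℕ} (hi : i ∈ S) : MultiAffine S (X i) := fun j => by
  rw [pderiv_X]
  constructor
  · rcases eq_or_ne i j with rfl | h <;> simp [*]
  · rintro hj
    rw [Pi.single_eq_of_ne]
    rintro rfl
    exact hj hi

theorem add (hp : MultiAffine S p) (hq : MultiAffine S q) : MultiAffine S (p + q) := fun i => by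
  refine ⟨by simp [(hp i).1, (hq i).1], fun hi => by simp [(hp i).2 hi, (hq i).2 hi]⟩

theorem neg (hp : MultiAffine S p) : MultiAffine S (-p) := fun i => by
  refine ⟨by simp [(hp i).1], fun hi => by simp [(hp i).2 hi]⟩

theorem sub (hp : MultiAffine S p) (hq : MultiAffine S q) : MultiAffine S (p - q) := by
  rw [sub_eq_add_neg]
  exact hp.add hq.neg

theorem sum {ι : Type*} {s : Finset ι} {f : ι → MvPolynomial ℕ ℝ}
    (h : ∀ i ∈ s, MultiAffine S (f i)) : MultiAffine S (∑ i ∈ s, f i) := fun i => by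
  simp only [map_sum]
  exact ⟨Finset.sum_eq_zero fun a ha => (h a ha i).1,
    fun hi => Finset.sum_eq_zero fun a ha => (h a ha i).2 hi⟩

/-- Disjoint variable sets are what keeps every degree at most one; cut loops satisfy this because
their strands share no label. -/
theorem mul (hp : MultiAffine S p) (hq : MultiAffine S' q) (hd : Disjoint S S') :
    MultiAffine (S ∪ S') (p * q) := fun i => by
  constructor
  · by_cases hi : i ∈ S
    · simp [(hp i).1, (hq i).2 (Finset.disjoint_left.mp hd hi)]
    · simp [(hq i).1, (hp i).2 hi]
  · intro hi
    rw [Finset.notMem_union] at hi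
    simp [(hp i).2 hi.1, (hq i).2 hi.2]

theorem prod_X (S : Finset ℕ) : MultiAffine S (∏ a ∈ S, (X a : MvPolynomial ℕ ℝ)) := by
  induction S using Finset.induction_on with
  | empty => simpa using const 1
  | insert a s ha ih =>
    rw [Finset.prod_insert ha, Finset.insert_eq]
    exact (var (Finset.mem_singleton_self a)).mul ih (by simpa using ha)

theorem pderiv (hp : MultiAffine S p) (i : ℕ) : MultiAffine (S.erase i) (pderiv i p) := fun j => by
  constructor
  · rw [pderiv_comm j i, pderiv_comm j i, (hp j).1, map_zero]
  · intro hj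
    rw [Finset.mem_erase, not_and_or, not_not] at hj
    rcases hj with rfl | hj
    · exact (hp _).1
    · rw [pderiv_comm, (hp j).2 hj, map_zero]

theorem rename_congr (hp : MultiAffine S p) {f g : ℕ → ℕ} (h : ∀ i ∈ S, f i = g i) :
    rename f p = rename g p := by
  refine hom_congr_vars (f₁ := (rename (R := ℝ) f).toRingHom)
    (f₂ := (rename (R := ℝ) g).toRingHom) (by ext; simp) (fun j hj _ => ?_) rfl
  simp [h j (hp.vars_subset hj)]

theorem rename_eq_self (hp : MultiAffine S p) {f : ℕ → ℕ} (h : ∀ i ∈ S, f i = i) :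
    rename f p = p := by
  rw [hp.rename_congr (g := id) (by simpa using h), rename_id_apply]

end MultiAffine

/-! ### Iterated derivatives -/

@[simp] theorem derivs_nil (p : MvPolynomial ℕ ℝ) : derivs [] p = p := rfl

@[simp] theorem derivs_cons (i : ℕ) (l : List ℕ) (p : MvPolynomial ℕ ℝ) :
    derivs (i :: l) p = derivs l (pderiv i p) := rfl

theorem derivs_append (l l' : List ℕ) (p : MvPolynomial ℕ ℝ) :
    derivs (l ++ l') p = derivs l' (derivs l p) := by
  simp [derivs]

theorem derivs_perm {l l' : List ℕ} (h : l.Perm l') (p : MvPolynomial ℕ ℝ) :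
    derivs l p = derivs l' p := by
  have : RightCommutative (fun (q : MvPolynomial ℕ ℝ) (i : ℕ) => pderiv i q) :=
    ⟨fun q i j => pderiv_comm j i q⟩
  exact h.foldl_eq p

theorem derivs_zero (l : List ℕ) : derivs l 0 = 0 := by
  induction l <;> simp_all

theorem derivs_add (l : List ℕ) (p q : MvPolynomial ℕ ℝ) :
    derivs l (p + q) = derivs l p + derivs l q := by
  induction l generalizing p q <;> simp_all

theorem derivs_neg (l : List ℕ) (p : MvPolynomial ℕ ℝ) :
    derivs l (-p) = -derivs l p := by
  induction l generalizing p <;> simp_all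

theorem derivs_sub (l : List ℕ) (p q : MvPolynomial ℕ ℝ) :
    derivs l (p - q) = derivs l p - derivs l q := by
  rw [sub_eq_add_neg, derivs_add, derivs_neg, sub_eq_add_neg]

theorem derivs_sum {ι : Type*} (l : List ℕ) (s : Finset ι) (f : ι → MvPolynomial ℕ ℝ) :
    derivs l (∑ i ∈ s, f i) = ∑ i ∈ s, derivs l (f i) := by
  induction l generalizing f <;> simp_all

theorem pderiv_derivs (i : ℕ) (l : List ℕ) (p : MvPolynomial ℕ ℝ) :
    pderiv i (derivs l p) = derivs l (pderiv i p) := by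
  induction l generalizing p with
  | nil => simp
  | cons a l ih => rw [derivs_cons, derivs_cons, ih, pderiv_comm]

theorem derivs_eq_zero {l : List ℕ} {i : ℕ} (hi : i ∈ l) {p : MvPolynomial ℕ ℝ}
    (hp : pderiv i p = 0) : derivs l p = 0 := by
  rw [derivs_perm (List.perm_cons_erase hi), derivs_cons, hp, derivs_zero]

theorem derivs_mul_of_right_free {l : List ℕ} (p : MvPolynomial ℕ ℝ) {q : MvPolynomial ℕ ℝ}
    (hq : ∀ i ∈ l, pderiv i q = 0) : derivs l (p * q) = derivs l p * q := by
  induction l generalizing p with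
  | nil => simp
  | cons a l ih =>
    rw [List.forall_mem_cons] at hq
    rw [derivs_cons, pderiv_mul, hq.1, mul_zero, add_zero, ih _ hq.2, derivs_cons]

theorem derivs_mul_of_left_free {l : List ℕ} {p : MvPolynomial ℕ ℝ} (q : MvPolynomial ℕ ℝ)
    (hp : ∀ i ∈ l, pderiv i p = 0) : derivs l (p * q) = p * derivs l q := by
  rw [mul_comm, derivs_mul_of_right_free q hp, mul_comm]

/-- The Leibniz rule has no cross terms here: each derivative can act on one factor only. -/
theorem derivs_mul_of_perm {l l₁ l₂ : List ℕ} (h : l.Perm (l₁ ++ l₂)) {p q : MvPolynomial ℕ ℝ}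
    (hp : ∀ i ∈ l₂, pderiv i p = 0) (hq : ∀ i ∈ l₁, pderiv i q = 0) :
    derivs l (p * q) = derivs l₁ p * derivs l₂ q := by
  rw [derivs_perm h, derivs_append, derivs_mul_of_right_free p hq,
    derivs_mul_of_left_free]
  intro i hi
  rw [pderiv_derivs, hp i hi, derivs_zero]

theorem derivs_atZero {l : List ℕ} {i : ℕ} (hi : i ∉ l) (p : MvPolynomial ℕ ℝ) :
    derivs l (atZero i p) = atZero i (derivs l p) := by
  induction l generalizing p with
  | nil => simp
  | cons a l ih =>
    rw [List.mem_cons, not_or] at hi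
    rw [derivs_cons, pderiv_atZero_of_ne hi.1, ih hi.2, derivs_cons]

theorem MultiAffine.derivs {S : Finset ℕ} {p : MvPolynomial ℕ ℝ} (hp : MultiAffine S p)
    (l : List ℕ) : MultiAffine (S \ l.toFinset) (derivs l p) := by
  induction l generalizing S p with
  | nil => simpa using hp
  | cons a l ih =>
    rw [derivs_cons]
    refine (ih (hp.pderiv a)).mono fun x hx => ?_
    simp only [Finset.mem_sdiff, Finset.mem_erase, List.mem_toFinset, List.mem_cons] at hx ⊢
    tauto

/-- Each derivative strips one variable from the monomial and cannot act on `q`. -/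
theorem derivs_prod_X_mul {l : List ℕ} (hl : l.Nodup) {S : Finset ℕ} (hS : ∀ i ∈ l, i ∈ S)
    {q : MvPolynomial ℕ ℝ} (hq : ∀ i ∈ l, pderiv i q = 0) :
    derivs l ((∏ a ∈ S, X a) * q) = (∏ a ∈ S \ l.toFinset, X a) * q := by
  induction l generalizing S with
  | nil => simp
  | cons a l ih =>
    rw [List.forall_mem_cons] at hS hq
    rw [List.nodup_cons] at hl
    have h1 : pderiv a (∏ b ∈ S.erase a, (X b : MvPolynomial ℕ ℝ)) = 0 :=
      (MultiAffine.prod_X _ a).2 (by simp)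
    rw [derivs_cons, ← Finset.mul_prod_erase S _ hS.1, pderiv_mul, pderiv_mul, hq.1, h1,
      pderiv_X_self, one_mul, mul_zero, add_zero, mul_zero, add_zero, ih hl.2 _ hq.2]
    · congr 2
      ext x
      simp only [Finset.mem_sdiff, Finset.mem_erase, List.mem_toFinset, List.mem_cons]
      tauto
    · intro i hi
      exact Finset.mem_erase.mpr ⟨fun h => hl.1 (h ▸ hi), hS.2 i hi⟩

/-- A multiaffine polynomial vanishes if its expansion along the first absent variable does. -/
theorem eq_zero_of_derivs_atZero (l : List ℕ) {p : MvPolynomial ℕ ℝ}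
    (h0 : ∀ l₁ b l₂, l = l₁ ++ b :: l₂ → atZero b (derivs l₁ p) = 0) (h1 : derivs l p = 0) :
    p = 0 := by
  induction l generalizing p with
  | nil => exact h1
  | cons a l ih =>
    have h2 : pderiv a p = 0 := ih (fun l₁ b l₂ hl => h0 (a :: l₁) b l₂ (by simp [hl])) h1
    have h3 := h0 [] a l rfl
    simpa [atZero, h2] using h3

/-! ### Strands of a loop -/

theorem rotate_idxOf {w t : List ℕ} {a : ℕ} (hw : w.Nodup) (h : w ~r a :: t) :
    w.rotate (w.idxOf a) = a :: t := by
  have ha : a ∈ w := h.mem_iff.mpr (by simp)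
  have h1 : w.rotate (w.idxOf a) ~r a :: t := (List.IsRotated.forall w _).trans h
  have hn : (w.rotate (w.idxOf a)).Nodup := List.nodup_rotate.mpr hw
  obtain ⟨n, hn'⟩ := h1
  have hi : w.idxOf a < w.length := List.idxOf_lt_length_of_mem ha
  have hpos : 0 < (w.rotate (w.idxOf a)).length := by
    rw [List.length_rotate]
    omega
  have h2 : (w.rotate (w.idxOf a))[0] = a := by
    rw [List.getElem_rotate]
    simp [Nat.mod_eq_of_lt hi]
  have h3 : ((w.rotate (w.idxOf a)).rotate n)[0]'(by simpa using hpos) = a := by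
    simp [hn']
  rw [List.getElem_rotate] at h3
  -- Both rotations begin with `a`, so distinctness of the entries makes the remaining rotation
  -- trivial modulo the length.
  have h4 := (hn.getElem_inj_iff).mp (h3.trans h2.symm)
  rw [zero_add] at h4
  rw [← hn', ← List.rotate_mod (w.rotate (w.idxOf a)) n, h4, List.rotate_zero]

theorem strand_of_isRotated {w u v : List ℕ} {a b : ℕ} (hw : w.Nodup)
    (h : w ~r a :: u ++ b :: v) : strand w a b = a :: u := by
  have hn : (a :: u ++ b :: v).Nodup := h.nodup_iff.mp hw
  rw [strand, rotate_idxOf (t := u ++ b :: v) hw h, ← List.cons_append, List.takeWhile_append_of_pos]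
  · simp
  · intro c hc
    have := List.disjoint_of_nodup_append hn hc
    simp only [List.mem_cons] at this
    simpa using fun h => this (Or.inl h)

/-- The normal form `(a u b v)` of a loop with two marked points, in which both strands can be read
off; facts about strands reduce to it. -/
theorem exists_strand {w : List ℕ} {a b : ℕ} (hw : w.Nodup) (ha : a ∈ w) (hb : b ∈ w)
    (hab : a ≠ b) : ∃ u v, w ~r a :: u ++ b :: v ∧ strand w a b = a :: u ∧
      strand w b a = b :: v := by
  obtain ⟨p, s, rfl⟩ := List.append_of_mem ha
  have hb' : b ∈ s ++ p := by
    simp only [List.mem_append, List.mem_cons] at hb ⊢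
    tauto
  obtain ⟨u, v, huv⟩ := List.append_of_mem hb'
  have h1 : (p ++ a :: s) ~r a :: u ++ b :: v := by
    rw [List.cons_append, ← huv, ← List.cons_append]
    exact List.isRotated_append
  exact ⟨u, v, h1, strand_of_isRotated hw h1,
    strand_of_isRotated hw (h1.trans List.isRotated_append)⟩

theorem strand_map {w : List ℕ} {f : ℕ → ℕ} (hf : (w.map f).Nodup) {a b : ℕ} (ha : a ∈ w)
    (hb : b ∈ w) (hab : a ≠ b) : strand (w.map f) (f a) (f b) = (strand w a b).map f := by
  obtain ⟨u, v, h, h1, -⟩ := exists_strand hf.of_map ha hb hab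
  rw [h1]
  refine strand_of_isRotated (u := u.map f) (v := v.map f) hf ?_
  simpa using h.map f

theorem strand_congr {w w' : List ℕ} (hw : w.Nodup) (h : w ~r w') {a b : ℕ} (ha : a ∈ w)
    (hb : b ∈ w) (hab : a ≠ b) : strand w a b = strand w' a b := by
  obtain ⟨u, v, h', h1, -⟩ := exists_strand hw ha hb hab
  rw [h1, strand_of_isRotated (h.nodup_iff.mp hw) (h.symm.trans h')]

section

variable {w : List ℕ} {a b : ℕ} (hw : w.Nodup) (ha : a ∈ w) (hb : b ∈ w) (hab : a ≠ b)

include hw ha hb hab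

theorem strand_append_perm : (strand w a b ++ strand w b a).Perm w := by
  obtain ⟨u, v, h, h1, h2⟩ := exists_strand hw ha hb hab
  rw [h1, h2]
  exact h.perm.symm

theorem strand_append_nodup : (strand w a b ++ strand w b a).Nodup :=
  (strand_append_perm hw ha hb hab).nodup_iff.mpr hw

theorem strand_nodup : (strand w a b).Nodup :=
  (strand_append_nodup hw ha hb hab).of_append_left

theorem left_mem_strand : a ∈ strand w a b := by
  obtain ⟨u, v, h, h1, h2⟩ := exists_strand hw ha hb hab
  simp [h1]

theorem length_strand_add : (strand w a b).length + (strand w b a).length = w.length := by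
  rw [← List.length_append, (strand_append_perm hw ha hb hab).length_eq]

theorem length_strand_pos : 0 < (strand w a b).length :=
  List.length_pos_of_mem (left_mem_strand hw ha hb hab)

theorem length_strand_lt : (strand w a b).length < w.length := by
  have h1 := length_strand_add hw ha hb hab
  have h2 := length_strand_pos hw hb ha hab.symm
  omega

theorem mem_of_mem_strand {x : ℕ} (hx : x ∈ strand w a b) : x ∈ w :=
  (strand_append_perm hw ha hb hab).mem_iff.mp (List.mem_append_left _ hx)

theorem mem_strand_or {x : ℕ} (hx : x ∈ w) : x ∈ strand w a b ∨ x ∈ strand w b a :=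
  List.mem_append.mp ((strand_append_perm hw ha hb hab).mem_iff.mpr hx)

theorem notMem_strand {x : ℕ} (hx : x ∈ strand w a b) : x ∉ strand w b a :=
  List.disjoint_of_nodup_append (strand_append_nodup hw ha hb hab) hx

end

/-! ### Labels in increasing order -/

theorem length_insertionSort_le (w : List ℕ) :
    (w.insertionSort (· ≤ ·)).length = w.length := List.length_insertionSort _ w

theorem label_eq_getElem {w : List ℕ} {i : ℕ} (h1 : 1 ≤ i) (h2 : i ≤ w.length) :
    label w i = (w.insertionSort (· ≤ ·))[i - 1]'(by rw [length_insertionSort_le]; omega) := by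
  rw [label, List.getD_eq_getElem]

theorem label_mem {w : List ℕ} {i : ℕ} (h1 : 1 ≤ i) (h2 : i ≤ w.length) : label w i ∈ w := by
  rw [label_eq_getElem h1 h2, ← List.mem_insertionSort (· ≤ ·)]
  exact List.getElem_mem _

theorem exists_label {w : List ℕ} {a : ℕ} (ha : a ∈ w) :
    ∃ i, 1 ≤ i ∧ i ≤ w.length ∧ label w i = a := by
  rw [← List.mem_insertionSort (· ≤ ·)] at ha
  obtain ⟨i, hi, rfl⟩ := List.mem_iff_getElem.mp ha
  have hi' := hi
  rw [length_insertionSort_le] at hi'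
  exact ⟨i + 1, by omega, by omega, by rw [label_eq_getElem (by omega) (by omega)]; simp⟩

theorem label_lt_label {w : List ℕ} (hw : w.Nodup) {i j : ℕ} (h1 : 1 ≤ i) (hij : i < j)
    (h2 : j ≤ w.length) : label w i < label w j := by
  rw [label_eq_getElem h1 (by omega), label_eq_getElem (by omega) h2]
  have hn : (w.insertionSort (· ≤ ·)).Nodup :=
    (List.perm_insertionSort (· ≤ ·) w).nodup_iff.mpr hw
  refine lt_of_le_of_ne ?_ fun h => ?_
  · exact List.sortedLE_insertionSort.getElem_le_getElem_of_le (by omega)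
  · have := hn.getElem_inj_iff.mp h
    omega

theorem label_lt_label_iff {w : List ℕ} (hw : w.Nodup) {i j : ℕ} (hi : 1 ≤ i)
    (hi' : i ≤ w.length) (hj : 1 ≤ j) (hj' : j ≤ w.length) :
    label w i < label w j ↔ i < j := by
  refine ⟨fun h => ?_, fun h => label_lt_label hw hi h hj'⟩
  by_contra hc
  rcases (not_lt.mp hc).eq_or_lt with rfl | h'
  · exact lt_irrefl _ h
  · exact lt_asymm h (label_lt_label hw hj h' hi')

theorem label_injOn {w : List ℕ} (hw : w.Nodup) {i j : ℕ} (hi : 1 ≤ i)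
    (hi' : i ≤ w.length) (hj : 1 ≤ j) (hj' : j ≤ w.length) (h : label w i = label w j) :
    i = j := by
  have h1 := label_lt_label_iff hw hi hi' hj hj'
  have h2 := label_lt_label_iff hw hj hj' hi hi'
  omega

theorem map_label_perm {w : List ℕ} (hw : w.Nodup) {n : ℕ} (h1 : 1 ≤ n) (h2 : n ≤ w.length) :
    ((List.range' 1 n).map (label w)).Perm (w.filter (· < label w n + 1)) := by
  rw [List.perm_ext_iff_of_nodup]
  · intro x
    simp only [List.mem_map, List.mem_range'_1, List.mem_filter, decide_eq_true_eq]
    constructor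
    · rintro ⟨i, hi, rfl⟩
      refine ⟨label_mem (by omega) (by omega), ?_⟩
      rw [Nat.lt_succ_iff, ← not_lt, label_lt_label_iff hw h1 h2 (by omega) (by omega)]
      omega
    · rintro ⟨hx, hx'⟩
      obtain ⟨i, hi, hi', rfl⟩ := exists_label hx
      rw [Nat.lt_succ_iff, ← not_lt, label_lt_label_iff hw h1 h2 hi hi'] at hx'
      exact ⟨i, by omega, rfl⟩
  · refine List.Nodup.map_on ?_ List.nodup_range'
    intro i hi j hj h
    rw [List.mem_range'_1] at hi hj
    exact label_injOn hw (by omega) (by omega) (by omega) (by omega) h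
  · exact hw.filter _

theorem filter_lt_label {w : List ℕ} (hw : w.Nodup) {j : ℕ} (hj : j + 1 ≤ w.length) :
    w.toFinset.filter (· < label w (j + 1)) = (Finset.Icc 1 j).image (label w) := by
  ext x
  simp only [Finset.mem_filter, List.mem_toFinset, Finset.mem_image, Finset.mem_Icc]
  constructor
  · rintro ⟨hx, h⟩
    obtain ⟨i, h1, h2, rfl⟩ := exists_label hx
    rw [label_lt_label_iff hw h1 h2 (by omega) hj] at h
    exact ⟨i, by omega, rfl⟩
  · rintro ⟨i, hi, rfl⟩
    exact ⟨label_mem hi.1 (by omega), label_lt_label hw hi.1 (by omega) hj⟩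

/-! ### The permutations `τ_{k+1} ⋯ τ_{k+n}` -/

/-- The product `τ_{k+1} ⋯ τ_{k+n}` of transpositions of successive labels of `w`. -/
def slidePerm (w : List ℕ) (k n : ℕ) : Equiv.Perm ℕ :=
  ((List.range' (k + 1) n).map fun i => Equiv.swap (label w i) (label w (i + 1))).prod

theorem slide_eq_map (w : List ℕ) (k j : ℕ) : slide w k j = w.map (slidePerm w k (j - k)) := rfl

theorem slidePerm_succ (w : List ℕ) (k n : ℕ) :
    slidePerm w k (n + 1) =
      Equiv.swap (label w (k + 1)) (label w (k + 2)) * slidePerm w (k + 1) n := by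
  simp [slidePerm, List.range'_succ]

theorem slidePerm_apply_last (w : List ℕ) (k n : ℕ) :
    slidePerm w k n (label w (k + n + 1)) = label w (k + 1) := by
  induction n generalizing k with
  | zero => simp [slidePerm]
  | succ n ih =>
    rw [slidePerm_succ, Equiv.Perm.mul_apply, show k + (n + 1) + 1 = k + 1 + n + 1 by ring, ih,
      Equiv.swap_apply_right]

theorem slidePerm_apply_of_ne {w : List ℕ} {k n x : ℕ}
    (hx : ∀ i, k + 1 ≤ i → i ≤ k + n + 1 → x ≠ label w i) : slidePerm w k n x = x := by
  induction n generalizing k with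
  | zero => simp [slidePerm]
  | succ n ih =>
    rw [slidePerm_succ, Equiv.Perm.mul_apply, ih fun i h1 h2 => hx i (by omega) (by omega),
      Equiv.swap_apply_of_ne_of_ne (hx _ (by omega) (by omega)) (hx _ (by omega) (by omega))]

/-- The product only permutes the labels of index `k + 1` to `k + n + 1` among themselves, so a
property shared by all of these is preserved and reflected. -/
theorem slidePerm_apply_iff {w : List ℕ} {k n : ℕ} {P : ℕ → Prop}
    (hP : ∀ i, k + 1 ≤ i → i ≤ k + n + 1 → P (label w i)) (x : ℕ) :
    P (slidePerm w k n x) ↔ P x := by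
  induction n generalizing k with
  | zero => simp [slidePerm]
  | succ n ih =>
    rw [slidePerm_succ, Equiv.Perm.mul_apply,
      ← ih (k := k + 1) fun i h1 h2 => hP i (by omega) (by omega)]
    have h1 := hP (k + 1) (by omega) (by omega)
    have h2 := hP (k + 2) (by omega) (by omega)
    rw [Equiv.swap_apply_def]
    split_ifs with h3 h4
    · simp [h2, h3, h1]
    · simp [h1, h4, h2]
    · rfl

/-! ### The recursion for the loop values -/

theorem hole_congr {F F' : List ℕ → MvPolynomial ℕ ℝ} {w : List ℕ} (hw : w.Nodup) {j : ℕ}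
    (hj : j + 1 ≤ w.length)
    (h : ∀ s : List ℕ, s.Nodup → 0 < s.length → s.length < w.length → F s = F' s) :
    hole F w j = hole F' w j := by
  rw [hole, hole]
  congr 1
  refine Finset.sum_congr rfl fun k hk => ?_
  rw [Finset.mem_Icc] at hk
  have hn : (slide w k j).Nodup := by
    rw [slide_eq_map]
    exact hw.map (Equiv.injective _)
  have hl : (slide w k j).length = w.length := by simp [slide]
  have hmem : ∀ i, k ≤ i → i ≤ j + 1 → label w i ∈ slide w k j := by
    intro i h1 h2
    -- The slide permutes the labels of `w`, so the preimage of a label is again in `w`.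
    have hP := slidePerm_apply_iff (w := w) (k := k) (n := j - k) (P := (· ∈ w))
      (fun i h1 h2 => label_mem (by omega) (by omega))
      ((slidePerm w k (j - k)).symm (label w i))
    rw [Equiv.apply_symm_apply] at hP
    rw [slide_eq_map, List.mem_map]
    exact ⟨_, hP.mp (label_mem (by omega) (by omega)), by simp⟩
  have hne : label w k ≠ label w (k + 1) :=
    (label_lt_label hw (by omega) (by omega) (by omega)).ne
  have ha := hmem k (by omega) (by omega)
  have hb := hmem (k + 1) (by omega) (by omega)
  rw [h _ (strand_nodup hn ha hb hne) (length_strand_pos hn ha hb hne)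
      (hl ▸ length_strand_lt hn ha hb hne),
    h _ (strand_nodup hn hb ha hne.symm) (length_strand_pos hn hb ha hne.symm)
      (hl ▸ length_strand_lt hn hb ha hne.symm)]

/-- Strands of a cut are strictly shorter than the loop, so the recursion bound is irrelevant once
it reaches the number of points. -/
theorem loopValueAux_eq (na : ℝ) {w : List ℕ} (hw : w.Nodup) (h0 : 0 < w.length) {n : ℕ}
    (hn : w.length ≤ n) : loopValueAux na n w = loopValue na w := by
  induction hm : w.length using Nat.strong_induction_on generalizing w n with
  | _ m ih =>
    have key : ∀ n, w.length ≤ n + 1 → ∀ j, j + 1 ≤ w.length →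
        hole (loopValueAux na n) w j = hole (loopValue na) w j := by
      intro n hn j hj
      refine hole_congr hw hj fun s hs hs0 hsw => ?_
      exact ih _ (hm ▸ hsw) hs hs0 (by omega) rfl
    have key2 : ∀ n, w.length ≤ n + 1 → w.length ≠ 1 → loopValueAux na (n + 1) w =
        (∑ j ∈ Finset.Icc 1 (w.length - 2),
          (∏ i ∈ Finset.Icc 1 j, X (label w i)) * hole (loopValue na) w j)
        + (∏ i ∈ Finset.Icc 1 (w.length - 1), X (label w i))
            * (1 - X (label w w.length)) * hole (loopValue na) w (w.length - 1) := by
      intro n hn h1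
      rw [loopValueAux, if_neg h1, key n hn _ (by omega)]
      congr 1
      refine Finset.sum_congr rfl fun j hj => ?_
      rw [Finset.mem_Icc] at hj
      rw [key n hn _ (by omega)]
    obtain ⟨n, rfl⟩ := Nat.exists_eq_succ_of_ne_zero (show n ≠ 0 by omega)
    obtain ⟨l, hl⟩ := Nat.exists_eq_succ_of_ne_zero (show w.length ≠ 0 by omega)
    rw [loopValue]
    by_cases h1 : w.length = 1
    · rw [hl, loopValueAux, loopValueAux, if_pos h1, if_pos h1]
    · rw [Nat.succ_eq_add_one, key2 n hn h1]
      conv_rhs => rw [hl]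
      rw [Nat.succ_eq_add_one, key2 l hl.le h1]

theorem loopValue_singleton (na : ℝ) (i : ℕ) : loopValue na [i] = C na + X i := by
  simp [loopValue, loopValueAux, label]

theorem loopValue_eq (na : ℝ) {w : List ℕ} (hw : w.Nodup) (h2 : 2 ≤ w.length) :
    loopValue na w =
      (∑ j ∈ Finset.Icc 1 (w.length - 2),
          (∏ i ∈ Finset.Icc 1 j, X (label w i)) * hole (loopValue na) w j)
        + (∏ i ∈ Finset.Icc 1 (w.length - 1), X (label w i))
            * (1 - X (label w w.length)) * hole (loopValue na) w (w.length - 1) := by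
  have key : ∀ j, j + 1 ≤ w.length →
      hole (loopValueAux na (w.length - 1)) w j = hole (loopValue na) w j := fun j hj =>
    hole_congr hw hj fun s hs hs0 hsw => loopValueAux_eq na hs hs0 (by omega)
  have h3 : w.length = w.length - 1 + 1 := by omega
  conv_lhs => rw [loopValue, h3]
  rw [loopValueAux, if_neg (by omega), key _ (by omega)]
  congr 1
  refine Finset.sum_congr rfl fun j hj => ?_
  rw [Finset.mem_Icc] at hj
  rw [key _ (by omega)]

/-! ### Derivatives along the lowest labels -/

/-- The derivative of the loop value along all labels smaller than `c`. -/
noncomputable def lowDeriv (na : ℝ) (w : List ℕ) (c : ℕ) : MvPolynomial ℕ ℝ :=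
  derivs (w.filter (· < c)) (loopValue na w)

/-- The sum over the points `a < b` of the products of the two loops obtained by cutting at `a`
and `b`, differentiated along all labels up to `b`. -/
noncomputable def holeAt (na : ℝ) (w : List ℕ) (b : ℕ) : MvPolynomial ℕ ℝ :=
  ∑ a ∈ w.toFinset.filter (· < b),
    lowDeriv na (strand w a b) (b + 1) * lowDeriv na (strand w b a) (b + 1)

theorem MultiAffine.lowDeriv {na : ℝ} {w : List ℕ}
    (h : MultiAffine w.toFinset (loopValue na w)) (c : ℕ) :
    MultiAffine (w.toFinset.filter (c ≤ ·)) (lowDeriv na w c) := by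
  refine (h.derivs _).mono fun x hx => ?_
  simp only [Finset.mem_sdiff, List.mem_toFinset, List.mem_filter, decide_eq_true_eq,
    Finset.mem_filter] at hx ⊢
  exact ⟨hx.1, not_lt.mp fun h => hx.2 ⟨hx.1, h⟩⟩

/-- All loops with fewer than `n` points have multiaffine values, whose derivatives along the
lowest labels are covariant under relabellings that mix these lowest labels. -/
structure GoodBelow (na : ℝ) (n : ℕ) : Prop where
  multiAffine : ∀ w : List ℕ, w.Nodup → 0 < w.length → w.length < n →
    MultiAffine w.toFinset (loopValue na w)
  lowDeriv_map : ∀ (w : List ℕ) (g : ℕ → ℕ) (c c' : ℕ), (w.map g).Nodup → 0 < w.length →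
    w.length < n → (∀ x ∈ w, g x < c' ↔ x < c) →
    (∀ x ∈ w, ∀ y ∈ w, c ≤ x → x < y → g x < g y) →
    lowDeriv na (w.map g) c' = rename g (lowDeriv na w c)

section

variable {na : ℝ} {w : List ℕ} (hG : GoodBelow na w.length) (hw : w.Nodup)

include hG hw

theorem GoodBelow.lowDeriv_strand_multiAffine {a b : ℕ} (ha : a ∈ w) (hb : b ∈ w) (hab : a ≠ b)
    (c : ℕ) :
    MultiAffine ((strand w a b).toFinset.filter (c ≤ ·)) (lowDeriv na (strand w a b) c) :=
  (hG.multiAffine _ (strand_nodup hw ha hb hab) (length_strand_pos hw ha hb hab)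
    (length_strand_lt hw ha hb hab)).lowDeriv c

theorem GoodBelow.holeAt_multiAffine {b : ℕ} (hb : b ∈ w) :
    MultiAffine (w.toFinset.filter (b < ·)) (holeAt na w b) := by
  refine MultiAffine.sum fun a ha => ?_
  simp only [Finset.mem_filter, List.mem_toFinset] at ha
  obtain ⟨ha, hab⟩ := ha
  refine ((hG.lowDeriv_strand_multiAffine hw ha hb hab.ne (b + 1)).mul
    (hG.lowDeriv_strand_multiAffine hw hb ha hab.ne' (b + 1)) ?_).mono ?_
  · rw [Finset.disjoint_left]
    intro x hx hx'
    simp only [Finset.mem_filter, List.mem_toFinset] at hx hx'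
    exact notMem_strand hw ha hb hab.ne hx.1 hx'.1
  · intro x hx
    simp only [Finset.mem_union, Finset.mem_filter, List.mem_toFinset, Nat.succ_le_iff] at hx ⊢
    rcases hx with hx | hx
    · exact ⟨mem_of_mem_strand hw ha hb hab.ne hx.1, hx.2⟩
    · exact ⟨mem_of_mem_strand hw hb ha hab.ne' hx.1, hx.2⟩

/-- Both strands of a cut are shorter loops, so their low derivatives are covariant; the set of cuts
below `b` is carried to the set below `g b`, since `g` respects the threshold `b`. -/
theorem GoodBelow.holeAt_map {g : ℕ → ℕ} {b : ℕ} (hb : b ∈ w) (hg : (w.map g).Nodup)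
    (h1 : ∀ x ∈ w, g x ≤ g b ↔ x ≤ b) (h2 : ∀ x ∈ w, ∀ y ∈ w, b < x → x < y → g x < g y) :
    holeAt na (w.map g) (g b) = rename g (holeAt na w b) := by
  have hinj : Set.InjOn g w.toFinset := by
    intro x hx y hy hxy
    rw [Finset.mem_coe, List.mem_toFinset] at hx hy
    exact List.inj_on_of_nodup_map hg hx hy hxy
  have himg : (w.map g).toFinset.filter (· < g b) = (w.toFinset.filter (· < b)).image g := by
    ext x
    simp only [Finset.mem_filter, List.mem_toFinset, List.mem_map, Finset.mem_image]
    constructor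
    · rintro ⟨⟨y, hy, rfl⟩, h⟩
      refine ⟨y, ⟨hy, lt_of_le_of_ne ((h1 y hy).mp h.le) ?_⟩, rfl⟩
      rintro rfl
      exact lt_irrefl _ h
    · rintro ⟨y, ⟨hy, h⟩, rfl⟩
      refine ⟨⟨y, hy, rfl⟩, lt_of_le_of_ne ((h1 y hy).mpr h.le) fun h' => ?_⟩
      exact h.ne (List.inj_on_of_nodup_map hg hy hb h')
  rw [holeAt, himg, Finset.sum_image (hinj.mono (by
    intro x hx
    simp only [Finset.coe_filter, Set.mem_ofPred_eq] at hx
    exact hx.1)), holeAt, map_sum]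
  refine Finset.sum_congr rfl fun a ha => ?_
  simp only [Finset.mem_filter, List.mem_toFinset] at ha
  obtain ⟨ha, hab⟩ := ha
  have key : ∀ a b' : ℕ, a ∈ w → b' ∈ w → a ≠ b' →
      lowDeriv na ((strand w a b').map g) (g b + 1) =
        rename g (lowDeriv na (strand w a b') (b + 1)) := by
    intro a b' ha hb' hab
    have hm : ∀ x ∈ strand w a b', x ∈ w := fun x hx => mem_of_mem_strand hw ha hb' hab hx
    refine hG.lowDeriv_map _ _ _ _ ?_ (length_strand_pos hw ha hb' hab)
      (length_strand_lt hw ha hb' hab) ?_ ?_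
    · exact (strand_nodup hw ha hb' hab).map_on fun x hx y hy h =>
        List.inj_on_of_nodup_map hg (hm x hx) (hm y hy) h
    · intro x hx
      rw [Nat.lt_succ_iff, Nat.lt_succ_iff]
      exact h1 x (hm x hx)
    · intro x hx y hy hbx hxy
      exact h2 x (hm x hx) y (hm y hy) hbx hxy
  rw [map_mul, strand_map hg ha hb hab.ne, strand_map hg hb ha hab.ne', key a b ha hb hab.ne,
    key b a hb ha hab.ne']

/-- The slide carries the label `b` of index `j + 1` to index `k + 1`, fixes `a` of index `k`, and
moves only labels up to `b`. Cutting the conjugate at indices `k`, `k + 1` is thus the relabelled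
cut of `w` at `a` and `b`, and the relabelling disappears because all labels up to `b` are
differentiated. -/
theorem GoodBelow.hole_eq_holeAt {j : ℕ} (hj : j + 1 ≤ w.length) :
    hole (loopValue na) w j = holeAt na w (label w (j + 1)) := by
  rw [hole, holeAt, filter_lt_label hw hj, derivs_sum, Finset.sum_image]
  swap
  · intro x hx y hy h
    rw [Finset.mem_coe, Finset.mem_Icc] at hx hy
    exact label_injOn hw hx.1 (by omega) hy.1 (by omega) h
  refine Finset.sum_congr rfl fun k hk => ?_
  rw [Finset.mem_Icc] at hk
  set a := label w k with ha'
  set b := label w (j + 1) with hb'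
  have ha : a ∈ w := label_mem hk.1 (by omega)
  have hb : b ∈ w := label_mem (by omega) hj
  have hab : a < b := label_lt_label hw hk.1 (by omega) hj
  set f := slidePerm w k (j - k) with hf
  have hlab : ∀ i, k + 1 ≤ i → i ≤ k + (j - k) + 1 → label w i ∈ w ∧ label w i < b + 1 := by
    intro i h1 h2
    refine ⟨label_mem (by omega) (by omega), ?_⟩
    rw [Nat.lt_succ_iff, ← not_lt, hb', label_lt_label_iff hw (by omega) hj (by omega) (by omega)]
    omega
  -- The moved labels have indices from `k + 1` on, so `a`, of index `k`, stays in place.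
  have hfa : f a = a := slidePerm_apply_of_ne fun i h1 h2 h => by
    have := label_injOn hw hk.1 (by omega) (by omega) (by omega) h
    omega
  have hfb : f b = label w (k + 1) := by
    rw [hf, hb', ← slidePerm_apply_last w k (j - k), show k + (j - k) + 1 = j + 1 by omega]
  have hfix : ∀ x, b + 1 ≤ x → f x = x := fun x hx => slidePerm_apply_of_ne fun i h1 h2 h => by
    have := (hlab i h1 h2).2
    omega
  have hlt : ∀ x, f x < b + 1 ↔ x < b + 1 :=
    slidePerm_apply_iff (P := (· < b + 1)) fun i h1 h2 => (hlab i h1 h2).2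
  have hmem : ∀ x, f x ∈ w ∧ f x < b + 1 ↔ x ∈ w ∧ x < b + 1 :=
    slidePerm_apply_iff (P := fun x => x ∈ w ∧ x < b + 1) hlab
  have hn : (w.map f).Nodup := hw.map f.injective
  rw [← hfb, slide_eq_map]
  conv_lhs => rw [← hfa]
  rw [strand_map hn ha hb hab.ne, strand_map hn hb ha hab.ne']
  have key : ∀ x y, x ∈ w → y ∈ w → x ≠ y →
      lowDeriv na ((strand w x y).map f) (b + 1) = lowDeriv na (strand w x y) (b + 1) := by
    intro x y hx hy hxy
    rw [hG.lowDeriv_map (strand w x y) f (b + 1) (b + 1)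
      ((strand_nodup hw hx hy hxy).map f.injective) (length_strand_pos hw hx hy hxy)
      (length_strand_lt hw hx hy hxy) (fun z _ => hlt z)]
    · refine (hG.lowDeriv_strand_multiAffine hw hx hy hxy _).rename_eq_self fun i hi => ?_
      exact hfix i (Finset.mem_filter.mp hi).2
    · intro u _ v _ h1 h2
      rwa [hfix u h1, hfix v (by omega)]
  rw [← key a b ha hb hab.ne, ← key b a hb ha hab.ne', lowDeriv, lowDeriv]
  have hMA : ∀ x y, x ∈ w → y ∈ w → x ≠ y → ∀ i, i ∉ (strand w x y).map f →
      pderiv i (loopValue na ((strand w x y).map f)) = 0 := by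
    intro x y hx hy hxy i hi
    refine (hG.multiAffine _ ((strand_nodup hw hx hy hxy).map f.injective) ?_ ?_ i).2 ?_
    · rw [List.length_map]
      exact length_strand_pos hw hx hy hxy
    · rw [List.length_map]
      exact length_strand_lt hw hx hy hxy
    · rwa [List.mem_toFinset]
  have hdisj := strand_append_nodup hw ha hb hab.ne
  have hdisj' : ((strand w a b).map f ++ (strand w b a).map f).Nodup := by
    rw [← List.map_append]
    exact hdisj.map f.injective
  refine derivs_mul_of_perm ?_ ?_ ?_
  -- The labels up to `b` are distributed over the two relabelled strands, so the derivative of the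
  -- product factorizes.
  · refine (map_label_perm hw (by omega) hj).trans ?_
    rw [← List.filter_append, ← List.map_append, List.perm_ext_iff_of_nodup (hw.filter _)
      ((hdisj.map f.injective).filter _)]
    intro x
    have h1 := hmem (f.symm x)
    rw [Equiv.apply_symm_apply] at h1
    simp only [List.mem_filter, decide_eq_true_eq, List.mem_map]
    rw [← hb', h1]
    constructor
    · rintro ⟨h2, h3⟩
      exact ⟨⟨_, (strand_append_perm hw ha hb hab.ne).mem_iff.mpr h2, by simp⟩, (h1.mpr ⟨h2, h3⟩).2⟩
    · rintro ⟨⟨y, hy, rfl⟩, h2⟩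
      rw [Equiv.symm_apply_apply]
      exact ⟨(strand_append_perm hw ha hb hab.ne).mem_iff.mp hy, (hlt y).mp h2⟩
  · intro i hi
    exact hMA a b ha hb hab.ne i fun h =>
      List.disjoint_of_nodup_append hdisj' h (List.mem_of_mem_filter hi)
  · intro i hi
    exact hMA b a hb ha hab.ne' i fun h =>
      List.disjoint_of_nodup_append hdisj' (List.mem_of_mem_filter hi) h

end

/-! ### Expansion along the first hole and the one-step recursion -/

theorem toFinset_eq_image_label {w : List ℕ} :
    w.toFinset = (Finset.range w.length).image fun j => label w (j + 1) := by
  ext x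
  simp only [List.mem_toFinset, Finset.mem_image, Finset.mem_range]
  constructor
  · intro hx
    obtain ⟨i, h1, h2, rfl⟩ := exists_label hx
    exact ⟨i - 1, by omega, by rw [Nat.sub_add_cancel h1]⟩
  · rintro ⟨j, hj, rfl⟩
    exact label_mem (by omega) (by omega)

section

variable {na : ℝ} {w : List ℕ} (hG : GoodBelow na w.length) (hw : w.Nodup)

include hG hw

/-- The expansion of the loop value along the first hole. -/
theorem GoodBelow.loopValue_eq_sum (h2 : 2 ≤ w.length) :
    loopValue na w = ∑ b ∈ w.toFinset, (∏ a ∈ w.toFinset.filter (· < b), X a) *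
      ((if ∀ x ∈ w, x ≤ b then 1 - X b else 1) * holeAt na w b) := by
  rw [toFinset_eq_image_label, Finset.sum_image, ← toFinset_eq_image_label]
  swap
  · intro x hx y hy h
    rw [Finset.mem_coe, Finset.mem_range] at hx hy
    have := label_injOn hw (by omega) (by omega) (by omega) (by omega) h
    omega
  have hprod : ∀ j, j + 1 ≤ w.length →
      (∏ a ∈ w.toFinset.filter (· < label w (j + 1)), X a : MvPolynomial ℕ ℝ) =
        ∏ i ∈ Finset.Icc 1 j, X (label w i) := by
    intro j hj
    rw [filter_lt_label hw hj, Finset.prod_image]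
    intro x hx y hy h
    rw [Finset.mem_coe, Finset.mem_Icc] at hx hy
    exact label_injOn hw hx.1 (by omega) hy.1 (by omega) h
  have hlast : ∀ j, j + 1 ≤ w.length →
      ((∀ x ∈ w, x ≤ label w (j + 1)) ↔ j + 1 = w.length) := by
    intro j hj
    constructor
    · intro h
      have := h _ (label_mem (i := w.length) (by omega) le_rfl)
      rw [← not_lt, label_lt_label_iff hw (by omega) hj (by omega) le_rfl] at this
      omega
    · intro h x hx
      obtain ⟨i, h1, h2, rfl⟩ := exists_label hx
      rw [← not_lt, label_lt_label_iff hw (by omega) hj h1 h2]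
      omega
  obtain ⟨m, hm⟩ : ∃ m, w.length = m + 2 := ⟨w.length - 2, by omega⟩
  rw [loopValue_eq na hw h2, hm, Finset.sum_range_succ, Finset.sum_range_succ',
    if_pos ((hlast (m + 1) (by omega)).mpr (by omega))]
  -- No cut lies below the smallest label, so the sum may run over all labels although the
  -- definition starts at the second.
  have h0 : holeAt na w (label w (0 + 1)) = 0 := by
    rw [holeAt, filter_lt_label hw (by omega)]
    simp
  rw [h0, mul_zero, mul_zero, add_zero, hprod _ (by omega),
    hG.hole_eq_holeAt hw (show m + 2 - 1 + 1 ≤ w.length by omega),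
    show m + 2 - 2 = m by omega, show m + 2 - 1 = m + 1 by omega, mul_assoc]
  congr 1
  rw [Finset.range_eq_Ico, Finset.sum_Ico_add' (fun j => (∏ a ∈ w.toFinset.filter
    (· < label w (j + 1)), X a : MvPolynomial ℕ ℝ) * ((if ∀ x ∈ w, x ≤ label w (j + 1) then
      1 - X (label w (j + 1)) else 1) * holeAt na w (label w (j + 1)))) 0 m 1]
  refine Finset.sum_congr (by rw [zero_add]; rfl) fun j hj => ?_
  rw [Finset.mem_Ico] at hj
  rw [hprod _ (by omega), if_neg, one_mul, hG.hole_eq_holeAt hw (by omega)]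
  rw [hlast _ (by omega)]
  omega

theorem GoodBelow.factor_multiAffine {b : ℕ} (hb : b ∈ w) :
    MultiAffine (w.toFinset.filter (b ≤ ·))
      ((if ∀ x ∈ w, x ≤ b then 1 - X b else 1) * holeAt na w b) := by
  have h1 : MultiAffine {b} (if ∀ x ∈ w, x ≤ b then 1 - X b else 1 : MvPolynomial ℕ ℝ) := by
    have h2 : MultiAffine {b} (1 : MvPolynomial ℕ ℝ) := by simpa using MultiAffine.const 1
    split_ifs
    · exact h2.sub (MultiAffine.var (by simp))
    · exact h2
  refine (h1.mul (hG.holeAt_multiAffine hw hb) (by simp)).mono fun x hx => ?_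
  simp only [Finset.mem_union, Finset.mem_singleton, Finset.mem_filter, List.mem_toFinset] at hx ⊢
  rcases hx with rfl | hx
  · exact ⟨hb, le_rfl⟩
  · exact ⟨hx.1, hx.2.le⟩

theorem GoodBelow.loopValue_multiAffine (h2 : 2 ≤ w.length) :
    MultiAffine w.toFinset (loopValue na w) := by
  rw [hG.loopValue_eq_sum hw h2]
  refine MultiAffine.sum fun b hb => ?_
  rw [List.mem_toFinset] at hb
  refine ((MultiAffine.prod_X _).mul (hG.factor_multiAffine hw hb) ?_).mono ?_
  · rw [Finset.disjoint_left]
    intro x hx hx'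
    simp only [Finset.mem_filter] at hx hx'
    omega
  · exact Finset.union_subset (Finset.filter_subset _ _) (Finset.filter_subset _ _)

/-- The term of `b` has the monomial in the labels below `b`. If `c ≤ b`, the derivatives only
shorten this monomial. If `b < c`, the variable `X b` is differentiated too, and it occurs in this
term only through `1 - X b`, at the largest label. -/
theorem GoodBelow.lowDeriv_eq_sum (h2 : 2 ≤ w.length) (c : ℕ) :
    lowDeriv na w c = ∑ b ∈ w.toFinset,
      if c ≤ b then (∏ a ∈ w.toFinset.filter (fun a => c ≤ a ∧ a < b), X a) *
        ((if ∀ x ∈ w, x ≤ b then 1 - X b else 1) * holeAt na w b)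
      else if ∀ x ∈ w, x ≤ b then -holeAt na w b else 0 := by
  rw [lowDeriv, hG.loopValue_eq_sum hw h2, derivs_sum]
  refine Finset.sum_congr rfl fun b hb => ?_
  rw [List.mem_toFinset] at hb
  have hf := hG.factor_multiAffine hw hb
  by_cases hc : c ≤ b
  · rw [if_pos hc, derivs_prod_X_mul (hw.filter _)]
    · congr 2
      ext x
      simp only [Finset.mem_sdiff, Finset.mem_filter, List.mem_toFinset, List.mem_filter,
        decide_eq_true_eq, not_and, not_lt]
      tauto
    · intro i hi
      simp only [List.mem_filter, decide_eq_true_eq] at hi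
      simp only [Finset.mem_filter, List.mem_toFinset]
      exact ⟨hi.1, by omega⟩
    · intro i hi
      refine (hf i).2 fun h => ?_
      simp only [List.mem_filter, decide_eq_true_eq] at hi
      rw [Finset.mem_filter] at h
      omega
  rw [if_neg hc]
  by_cases hl : ∀ x ∈ w, x ≤ b
  · have hperm : (w.filter (· < c)).Perm (b :: w.filter (· < b)) := by
      rw [List.perm_ext_iff_of_nodup (hw.filter _)
        (List.nodup_cons.mpr ⟨by simp, hw.filter _⟩)]
      intro x
      simp only [List.mem_filter, decide_eq_true_eq, List.mem_cons]
      constructor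
      · rintro ⟨h1, h3⟩
        exact (hl x h1).eq_or_lt.imp id fun h => ⟨h1, h⟩
      · rintro (rfl | ⟨h1, h3⟩)
        · exact ⟨hb, by omega⟩
        · exact ⟨h1, by omega⟩
    have hp : pderiv b (∏ a ∈ w.toFinset.filter (· < b), (X a : MvPolynomial ℕ ℝ)) = 0 :=
      (MultiAffine.prod_X _ b).2 (by simp)
    have hh := hG.holeAt_multiAffine hw hb
    rw [if_pos hl, if_pos hl, derivs_perm hperm, derivs_cons, pderiv_mul, pderiv_mul, hp, (hh b).2 (by simp)]
    simp only [map_sub, Derivation.map_one_eq_zero, pderiv_X_self, zero_mul, mul_zero,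
      add_zero, zero_add, zero_sub, neg_mul, one_mul]
    rw [derivs_prod_X_mul (hw.filter _)]
    · rw [Finset.prod_eq_one, one_mul]
      intro x hx
      simp only [Finset.mem_sdiff, Finset.mem_filter, List.mem_toFinset, List.mem_filter,
        decide_eq_true_eq] at hx
      tauto
    · intro i hi
      simpa using hi
    · intro i hi
      rw [map_neg, (hh i).2, neg_zero]
      simp only [List.mem_filter, decide_eq_true_eq] at hi
      rw [Finset.mem_filter]
      omega
  · rw [if_neg hl, if_neg hl]
    refine derivs_eq_zero (i := b) (by simpa using ⟨hb, by omega⟩) ?_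
    rw [pderiv_mul, (MultiAffine.prod_X _ b).2 (by simp), one_mul,
      (hG.holeAt_multiAffine hw hb b).2 (by simp), zero_mul, mul_zero, add_zero]

/-- Compare the two expansions term by term: terms beyond `b` differ exactly by the factor `X b`,
terms before `b` vanish since they are not at the largest label, and the term at `b` leaves
`holeAt`. -/
theorem GoodBelow.lowDeriv_eq_holeAt_add (h2 : 2 ≤ w.length) {b : ℕ} (hb : b ∈ w) :
    lowDeriv na w b = holeAt na w b + X b * lowDeriv na w (b + 1) := by
  rw [← sub_eq_iff_eq_add, hG.lowDeriv_eq_sum hw h2, hG.lowDeriv_eq_sum hw h2, Finset.mul_sum,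
    ← Finset.sum_sub_distrib, Finset.sum_eq_single_of_mem b (by simpa using hb)]
  · rw [if_pos le_rfl, if_neg (Nat.not_succ_le_self b),
      Finset.filter_false_of_mem (fun x _ => by omega)]
    -- With `H` the value of `holeAt` at `b`, the largest label contributes `(1 - X b) * H` and `-H`
    -- to the two sums, and `(1 - X b) * H + X b * H = H`.
    by_cases hl : ∀ x ∈ w, x ≤ b
    · rw [if_pos hl, if_pos hl, Finset.prod_empty]
      ring
    · rw [if_neg hl, if_neg hl, Finset.prod_empty]
      ring
  · intro b' hb' hne
    rw [List.mem_toFinset] at hb'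
    rcases lt_or_gt_of_ne hne with h | h
    · have hl : ¬∀ x ∈ w, x ≤ b' := fun hl => by
        have := hl b hb
        omega
      rw [if_neg (by omega), if_neg hl, if_neg (by omega)]
      simp
    · have hs : (w.toFinset.filter fun a => b ≤ a ∧ a < b').erase b =
          w.toFinset.filter fun a => b + 1 ≤ a ∧ a < b' := by
        ext x
        simp only [Finset.mem_erase, Finset.mem_filter]
        constructor
        · rintro ⟨h1, h3, h4, h5⟩
          exact ⟨h3, by omega, h5⟩
        · rintro ⟨h1, h3, h4⟩
          exact ⟨by omega, h1, by omega, h4⟩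
      rw [if_pos h.le, if_pos (Nat.succ_le_of_lt h), sub_eq_zero, ← mul_assoc (X b),
        ← hs, Finset.mul_prod_erase _ (fun a => (X a : MvPolynomial ℕ ℝ))]
      simpa using ⟨hb, h⟩

end

/-! ### Full derivatives, Catalan numbers and the end of the induction -/

theorem holeAt_congr (na : ℝ) {w w' : List ℕ} (hw : w.Nodup) (h : w ~r w') {b : ℕ} (hb : b ∈ w) :
    holeAt na w b = holeAt na w' b := by
  have hs : w.toFinset = w'.toFinset := List.toFinset_eq_of_perm _ _ h.perm
  rw [holeAt, holeAt, hs]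
  refine Finset.sum_congr rfl fun a ha => ?_
  rw [← hs, Finset.mem_filter, List.mem_toFinset] at ha
  rw [strand_congr hw h ha.1 hb ha.2.ne, strand_congr hw h hb ha.1 ha.2.ne']

/-- The value of the derivative of an `n`-point loop along all its points. -/
noncomputable def fullDeriv (n : ℕ) : ℝ := (-1) ^ (n - 1) * catalan (n - 1)

theorem fullDeriv_eq_sum {n : ℕ} :
    fullDeriv (n + 2) = -∑ i ∈ Finset.range (n + 1), fullDeriv (i + 1) * fullDeriv (n + 1 - i) := by
  rw [fullDeriv, show n + 2 - 1 = n + 1 by rfl, catalan_succ',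
    Finset.Nat.sum_antidiagonal_eq_sum_range_succ fun i j => catalan i * catalan j]
  push_cast
  rw [Finset.mul_sum, ← Finset.sum_neg_distrib]
  refine Finset.sum_congr rfl fun i hi => ?_
  rw [Finset.mem_range] at hi
  rw [fullDeriv, fullDeriv, show i + 1 - 1 = i by rfl, show n + 1 - i - 1 = n - i by omega]
  have h : (-1 : ℝ) ^ (n + 1) = -((-1) ^ i * (-1) ^ (n - i)) := by
    rw [← pow_add, show i + (n - i) = n by omega, pow_succ]
    ring
  rw [h]
  ring

/-- Rotate the loop so that its largest point comes first. Every other point is then a cut, and the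
cuts realize each splitting of the length into two positive parts exactly once, which is the Catalan
convolution. -/
theorem holeAt_eq_of_full {na : ℝ} {w : List ℕ} (hw : w.Nodup) (h2 : 2 ≤ w.length) {b : ℕ}
    (hb : b ∈ w) (hl : ∀ x ∈ w, x ≤ b)
    (h : ∀ s : List ℕ, s.Nodup → 0 < s.length → s.length < w.length → ∀ c, (∀ x ∈ s, x < c) →
      lowDeriv na s c = C (fullDeriv s.length)) :
    holeAt na w b = -C (fullDeriv w.length) := by
  obtain ⟨p, s, rfl⟩ := List.append_of_mem hb
  have hr : (p ++ b :: s) ~r b :: (s ++ p) := by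
    rw [← List.cons_append]
    exact List.isRotated_append
  rw [holeAt_congr na hw hr hb]
  have hn := hr.nodup_iff.mp hw
  have hlen := hr.perm.length_eq
  have hmem : ∀ x ∈ b :: (s ++ p), x ≤ b := fun x hx => hl x (hr.mem_iff.mpr hx)
  rw [hlen] at h h2 ⊢
  clear hl hb hw hr hlen
  generalize s ++ p = u at *
  obtain ⟨n, hu⟩ : ∃ n, u.length = n + 1 := ⟨u.length - 1, by simp at h2; omega⟩
  have himg : (b :: u).toFinset.filter (· < b) =
      (Finset.range (n + 1)).image fun i => u.getD i 0 := by
    ext x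
    simp only [Finset.mem_filter, List.mem_toFinset, List.mem_cons, Finset.mem_image,
      Finset.mem_range]
    constructor
    · rintro ⟨hx, hxb⟩
      obtain ⟨i, hi, rfl⟩ := List.mem_iff_getElem.mp (hx.resolve_left hxb.ne)
      exact ⟨i, by omega, by simp [hi]⟩
    · rintro ⟨i, hi, rfl⟩
      have hi' : i < u.length := by omega
      rw [List.getD_eq_getElem _ _ hi']
      have hm : u[i] ∈ u := List.getElem_mem _
      refine ⟨Or.inr hm, lt_of_le_of_ne (hmem _ (by simp)) fun h => ?_⟩
      exact (List.nodup_cons.mp hn).1 (h ▸ hm)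
  rw [holeAt, himg, Finset.sum_image, List.length_cons, hu, fullDeriv_eq_sum, map_neg, neg_neg,
    map_sum]
  · refine Finset.sum_congr rfl fun i hi => ?_
    rw [Finset.mem_range] at hi
    have hi' : i < u.length := by omega
    rw [List.getD_eq_getElem _ _ hi']
    have hsplit : b :: u = (b :: u.take i) ++ u[i] :: u.drop (i + 1) := by
      simp
    have h1 : strand (b :: u) b u[i] = b :: u.take i :=
      strand_of_isRotated hn (by rw [← hsplit])
    have h3 : strand (b :: u) u[i] b = u[i] :: u.drop (i + 1) :=
      strand_of_isRotated (v := u.take i) hn (by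
        conv_lhs => rw [hsplit]
        exact List.isRotated_append)
    have hn' := hn
    rw [hsplit] at hn'
    rw [h1, h3, h _ hn'.of_append_left (by simp) (by simp; omega),
      h _ hn'.of_append_right (by simpa using hi') (by simp), ← map_mul, mul_comm]
    · simp [show min i u.length = i by omega, ← hu]
    · intro x hx
      rw [Nat.lt_succ_iff]
      refine hmem x ?_
      rw [hsplit]
      exact List.mem_append_right _ hx
    · intro x hx
      rw [Nat.lt_succ_iff]
      refine hmem x ?_
      rw [hsplit]
      exact List.mem_append_left _ hx
  · intro i hi j hj hij
    rw [Finset.mem_coe, Finset.mem_range] at hi hj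
    simp only at hij
    rw [List.getD_eq_getElem _ _ (by omega), List.getD_eq_getElem _ _ (by omega)] at hij
    exact (List.nodup_cons.mp hn).2.getElem_inj_iff.mp hij

theorem exists_last {w : List ℕ} (h : 0 < w.length) : ∃ b ∈ w, ∀ x ∈ w, x ≤ b := by
  obtain ⟨b, hb, h'⟩ := w.toFinset.exists_max_image id
    ⟨w[0], List.mem_toFinset.mpr (List.getElem_mem _)⟩
  exact ⟨b, List.mem_toFinset.mp hb, fun x hx => h' x (List.mem_toFinset.mpr hx)⟩

theorem GoodBelow.lowDeriv_eq_neg_holeAt {na : ℝ} {w : List ℕ} (hG : GoodBelow na w.length)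
    (hw : w.Nodup) (h2 : 2 ≤ w.length) {b c : ℕ} (hb : b ∈ w) (hl : ∀ x ∈ w, x ≤ b)
    (hc : b < c) : lowDeriv na w c = -holeAt na w b := by
  rw [hG.lowDeriv_eq_sum hw h2, Finset.sum_eq_single_of_mem b (List.mem_toFinset.mpr hb)]
  · rw [if_neg (by omega), if_pos hl]
  · intro x hx hxb
    rw [List.mem_toFinset] at hx
    have h1 := hl x hx
    rw [if_neg (by omega), if_neg]
    intro h
    have := h b hb
    omega

theorem GoodBelow.mono {na : ℝ} {m n : ℕ} (h : GoodBelow na n) (hmn : m ≤ n) : GoodBelow na m :=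
  ⟨fun w hw h0 hm => h.multiAffine w hw h0 (hm.trans_le hmn),
    fun w g c c' hw h0 hm => h.lowDeriv_map w g c c' hw h0 (hm.trans_le hmn)⟩

theorem GoodBelow.lowDeriv_eq_fullDeriv {na : ℝ} {n : ℕ} (hG : GoodBelow na n) {w : List ℕ}
    (hw : w.Nodup) (h0 : 0 < w.length) (hn : w.length ≤ n) {c : ℕ} (hc : ∀ x ∈ w, x < c) :
    lowDeriv na w c = C (fullDeriv w.length) := by
  induction hm : w.length using Nat.strong_induction_on generalizing w c with
  | _ m ih =>
    subst hm
    by_cases h1 : w.length = 1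
    · obtain ⟨i, rfl⟩ := List.length_eq_one_iff.mp h1
      have hi : i < c := hc i (by simp)
      simp [lowDeriv, hi, loopValue_singleton, fullDeriv]
    · obtain ⟨b, hb, hl⟩ := exists_last h0
      rw [(hG.mono hn).lowDeriv_eq_neg_holeAt hw (by omega) hb hl (hc b hb),
        holeAt_eq_of_full hw (by omega) hb hl, neg_neg]
      intro s hs h0 hsw c hc
      exact ih _ hsw hs h0 (by omega) hc rfl

/-- If some label is at or above the threshold, terms below the threshold vanish on both sides and
the other terms are covariant through `holeAt_map`. If none is, `g` may move the largest label
anywhere, and only the Catalan value of the full derivative gives invariance. -/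
theorem GoodBelow.lowDeriv_map_of_le {na : ℝ} {n : ℕ} (hG : GoodBelow na n) {w : List ℕ}
    {g : ℕ → ℕ} {c c' : ℕ} (hg : (w.map g).Nodup) (h0 : 0 < w.length) (hn : w.length ≤ n)
    (h1 : ∀ x ∈ w, g x < c' ↔ x < c) (h2 : ∀ x ∈ w, ∀ y ∈ w, c ≤ x → x < y → g x < g y) :
    lowDeriv na (w.map g) c' = rename g (lowDeriv na w c) := by
  have hw : w.Nodup := hg.of_map
  by_cases hc : ∀ x ∈ w, x < c
  · rw [hG.lowDeriv_eq_fullDeriv hw h0 hn hc, hG.lowDeriv_eq_fullDeriv hg (by simpa using h0)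
      (by simpa using hn), List.length_map, rename_C]
    intro x hx
    obtain ⟨y, hy, rfl⟩ := List.mem_map.mp hx
    exact (h1 y hy).mpr (hc y hy)
  push Not at hc
  obtain ⟨z, hz, hcz⟩ := hc
  by_cases hlen : w.length = 1
  · obtain ⟨i, rfl⟩ := List.length_eq_one_iff.mp hlen
    obtain rfl : z = i := by simpa using hz
    have hgz : ¬ g z < c' := by
      rw [h1 z hz]
      omega
    simp [lowDeriv, loopValue_singleton, hgz, hcz.not_gt]
  have hlen' : 2 ≤ w.length := by omega
  have hmaplen : (w.map g).length = w.length := List.length_map _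
  have hinj : Set.InjOn g w.toFinset := by
    intro x hx y hy hxy
    rw [Finset.mem_coe, List.mem_toFinset] at hx hy
    exact List.inj_on_of_nodup_map hg hx hy hxy
  have himg : (w.map g).toFinset = w.toFinset.image g := by
    ext x
    simp
  have hlt : ∀ b ∈ w, c ≤ b → ∀ x ∈ w, g x < g b ↔ x < b := by
    intro b hb hcb x hx
    constructor
    · intro h
      by_contra hbx
      rcases (not_lt.mp hbx).eq_or_lt with rfl | h'
      · exact lt_irrefl _ h
      · exact lt_asymm h (h2 b hb x hx hcb h')
    · intro h
      by_cases hx' : c ≤ x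
      · exact h2 x hx b hb hx' h
      · have h3 := (h1 x hx).mpr (by omega)
        have h4 := (h1 b hb).not.mpr (by omega)
        omega
  have hle : ∀ b ∈ w, c ≤ b → ∀ x ∈ w, g x ≤ g b ↔ x ≤ b := by
    intro b hb hcb x hx
    rw [le_iff_lt_or_eq, le_iff_lt_or_eq, hlt b hb hcb x hx]
    refine or_congr_right ⟨fun h => List.inj_on_of_nodup_map hg hx hb h, fun h => h ▸ rfl⟩
  rw [((hG.mono hn).mono hmaplen.le).lowDeriv_eq_sum hg (by omega), (hG.mono hn).lowDeriv_eq_sum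
    hw hlen', himg, Finset.sum_image hinj, map_sum]
  refine Finset.sum_congr rfl fun b hb => ?_
  rw [List.mem_toFinset] at hb
  by_cases hcb : c ≤ b
  · have hcb' : c' ≤ g b := not_lt.mp ((h1 b hb).not.mpr (not_lt.mpr hcb))
    have hlast : (∀ x ∈ w.map g, x ≤ g b) ↔ ∀ x ∈ w, x ≤ b := by
      rw [List.forall_mem_map]
      exact forall₂_congr fun x hx => hle b hb hcb x hx
    have hfil : (w.toFinset.image g).filter (fun a => c' ≤ a ∧ a < g b) =
        (w.toFinset.filter fun a => c ≤ a ∧ a < b).image g := by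
      rw [Finset.filter_image]
      congr 1
      refine Finset.filter_congr fun x hx => ?_
      rw [List.mem_toFinset] at hx
      rw [hlt b hb hcb x hx, ← not_lt, h1 x hx, not_lt]
    rw [if_pos hcb, if_pos hcb', hfil, Finset.prod_image (hinj.mono (by
      intro x hx
      simp only [Finset.coe_filter, Set.mem_ofPred_eq] at hx
      exact hx.1)), (hG.mono hn).holeAt_map hw hb hg (hle b hb hcb)
      (fun x hx y hy h h' => h2 x hx y hy (hcb.trans h.le) h'), map_mul, map_mul, map_prod]
    simp only [rename_X]
    by_cases hl : ∀ x ∈ w, x ≤ b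
    · rw [if_pos hl, if_pos (hlast.mpr hl)]
      simp
    · rw [if_neg hl, if_neg (hlast.not.mpr hl)]
      simp
  · have hb' := (h1 b hb).mpr (by omega)
    have hz' := (h1 z hz).not.mpr (by omega)
    -- The label `z` lies at or above the threshold, so `b` is not the largest label, before or
    -- after relabelling.
    rw [if_neg hcb, if_neg (by omega), if_neg fun h => ?_, if_neg fun h => ?_, map_zero]
    · have := h z hz
      omega
    · have := h (g z) (List.mem_map_of_mem hz)
      omega

/-- Covariance for loops of `n` points needs `GoodBelow` only for strictly shorter loops, which is
why the induction closes. -/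
theorem goodBelow (na : ℝ) (n : ℕ) : GoodBelow na n := by
  induction n with
  | zero => exact ⟨fun w _ _ h => absurd h (by omega), fun w _ _ _ _ _ h => absurd h (by omega)⟩
  | succ n ih =>
    refine ⟨fun w hw h0 hn => ?_, fun w g c c' hg h0 hn h1 h2 =>
      ih.lowDeriv_map_of_le hg h0 (by omega) h1 h2⟩
    by_cases hlen : w.length = 1
    · obtain ⟨i, rfl⟩ := List.length_eq_one_iff.mp hlen
      rw [loopValue_singleton]
      exact (MultiAffine.const na).add (MultiAffine.var (by simp))
    · exact (ih.mono (by omega)).loopValue_multiAffine hw (by omega)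

/-! ### Consequences for all loops -/

theorem loopValue_multiAffine (na : ℝ) {w : List ℕ} (hw : w.Nodup) (h0 : 0 < w.length) :
    MultiAffine w.toFinset (loopValue na w) :=
  (goodBelow na (w.length + 1)).multiAffine w hw h0 (by omega)

theorem lowDeriv_map (na : ℝ) {w : List ℕ} {g : ℕ → ℕ} {c c' : ℕ} (hg : (w.map g).Nodup)
    (h0 : 0 < w.length) (h1 : ∀ x ∈ w, g x < c' ↔ x < c)
    (h2 : ∀ x ∈ w, ∀ y ∈ w, c ≤ x → x < y → g x < g y) :
    lowDeriv na (w.map g) c' = rename g (lowDeriv na w c) :=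
  (goodBelow na w.length).lowDeriv_map_of_le hg h0 le_rfl h1 h2

theorem lowDeriv_eq_holeAt_add (na : ℝ) {w : List ℕ} (hw : w.Nodup) (h2 : 2 ≤ w.length) {b : ℕ}
    (hb : b ∈ w) : lowDeriv na w b = holeAt na w b + X b * lowDeriv na w (b + 1) :=
  (goodBelow na w.length).lowDeriv_eq_holeAt_add hw h2 hb

theorem loopValue_congr (na : ℝ) {w w' : List ℕ} (hw : w.Nodup) (h : w ~r w') :
    loopValue na w = loopValue na w' := by
  have hlen := h.perm.length_eq
  rcases Nat.lt_or_ge w.length 2 with h2 | h2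
  · rcases Nat.lt_or_ge w.length 1 with h1 | h1
    · rw [List.length_eq_zero_iff.mp (show w.length = 0 by omega),
        List.length_eq_zero_iff.mp (show w'.length = 0 by omega)]
    · obtain ⟨i, rfl⟩ := List.length_eq_one_iff.mp (show w.length = 1 by omega)
      rw [List.isRotated_singleton_iff'.mp h]
  · have hs : w.toFinset = w'.toFinset := List.toFinset_eq_of_perm _ _ h.perm
    rw [(goodBelow na _).loopValue_eq_sum hw h2,
      (goodBelow na _).loopValue_eq_sum (h.nodup_iff.mp hw) (hlen ▸ h2), hs]
    refine Finset.sum_congr rfl fun b hb => ?_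
    rw [← hs, List.mem_toFinset] at hb
    simp only [h.mem_iff, holeAt_congr na hw h hb]

theorem lowDeriv_congr (na : ℝ) {w w' : List ℕ} (hw : w.Nodup) (h : w ~r w') (c : ℕ) :
    lowDeriv na w c = lowDeriv na w' c := by
  rw [lowDeriv, lowDeriv, loopValue_congr na hw h, derivs_perm (h.perm.filter _)]

/-! ### Uniqueness of the solution of the stationarity conditions -/

theorem atZero_sub (i : ℕ) (p q : MvPolynomial ℕ ℝ) :
    atZero i (p - q) = atZero i p - atZero i q := by
  simp only [atZero, map_sub]
  ring

/-- The content of the continuity and gluing conditions at `X a = X b` for polynomials which are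
affine in `X a` and in `X b`. -/
theorem atZero_pderiv_eq_of_gluing {a b : ℕ} (hab : a ≠ b) {p p' R : MvPolynomial ℕ ℝ}
    (hp : ∀ i, pderiv i (pderiv i p) = 0) (hp' : ∀ i, pderiv i (pderiv i p') = 0)
    (hc : aeval (Function.update X a (X b : MvPolynomial ℕ ℝ)) p =
      aeval (Function.update X a (X b : MvPolynomial ℕ ℝ)) p')
    (hg : aeval (Function.update X a (X b : MvPolynomial ℕ ℝ))
      (pderiv a (p + p') - pderiv b (p + p')) = 2 * R) :
    atZero b (pderiv a p) = atZero a (pderiv b p') + R := by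
  have e1 : ∀ q : MvPolynomial ℕ ℝ, (∀ i, pderiv i (pderiv i q) = 0) →
      pderiv a (pderiv a (pderiv b q)) = 0 := fun q hq => by
    rw [pderiv_comm a b, pderiv_comm a b, hq, map_zero]
  have e2 : ∀ q : MvPolynomial ℕ ℝ, (∀ i, pderiv i (pderiv i q) = 0) →
      pderiv b (pderiv b (pderiv a q)) = 0 := fun q hq => by
    rw [pderiv_comm b a, pderiv_comm b a, hq, map_zero]
  rw [aeval_update_eq (hp a), aeval_update_eq (hp' a)] at hc
  rw [aeval_update_eq (by simp [hp, hp', e1])] at hg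
  -- Write `p = α + β X_a + γ X_b + δ X_a X_b` and likewise `p'`. Continuity gives `β + γ = β' + γ'`
  -- and `δ = δ'` from its first two derivatives; gluing gives `β + β' - γ - γ' = 2R`. Adding yields
  -- `β = γ' + R`.
  have h1 := congrArg (pderiv b) hc
  simp only [atZero, map_add, map_sub, pderiv_mul, pderiv_X_self, pderiv_X_of_ne hab, zero_mul,
    zero_add, one_mul, hp, hp', pderiv_comm a b] at h1 hg ⊢
  have h2 := congrArg (pderiv b) h1
  simp only [map_add, map_sub, pderiv_mul, pderiv_X_self, pderiv_X_of_ne hab, zero_mul,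
    zero_add, one_mul, hp, hp', e2 p hp, e2 p' hp', mul_zero, sub_zero, add_zero] at h2
  have h3 : (2 : MvPolynomial ℕ ℝ) ≠ 0 := two_ne_zero
  apply mul_left_cancel₀ h3
  linear_combination hg + h1 - X b * h2

/-! ### Moving the threshold and exchanging neighbouring labels -/

theorem lowDeriv_of_notMem (na : ℝ) {s : List ℕ} {b : ℕ} (hb : b ∉ s) :
    lowDeriv na s (b + 1) = lowDeriv na s b := by
  rw [lowDeriv, lowDeriv]
  congr 1
  refine List.filter_congr fun x hx => ?_
  have : x ≠ b := fun h => hb (h ▸ hx)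
  rw [decide_eq_decide]
  omega

theorem filter_lt_succ_perm {s : List ℕ} (hs : s.Nodup) {b : ℕ} (hb : b ∈ s) :
    (s.filter (· < b + 1)).Perm (b :: s.filter (· < b)) := by
  rw [List.perm_ext_iff_of_nodup (hs.filter _) (List.nodup_cons.mpr ⟨by simp, hs.filter _⟩)]
  intro x
  simp only [List.mem_filter, decide_eq_true_eq, List.mem_cons, Nat.lt_succ_iff_lt_or_eq]
  constructor
  · tauto
  · rintro (rfl | h)
    · exact ⟨hb, Or.inr rfl⟩
    · exact ⟨h.1, Or.inl h.2⟩

theorem pderiv_lowDeriv_of_mem (na : ℝ) {s : List ℕ} (hs : s.Nodup) {b : ℕ} (hb : b ∈ s) :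
    pderiv b (lowDeriv na s b) = lowDeriv na s (b + 1) := by
  rw [lowDeriv, lowDeriv, derivs_perm (filter_lt_succ_perm hs hb), derivs_cons, pderiv_derivs]

theorem lowDeriv_of_gap (na : ℝ) {s : List ℕ} {a b : ℕ} (hab : a < b)
    (h : ∀ x ∈ s, x ≤ a ∨ b ≤ x) : lowDeriv na s (a + 1) = lowDeriv na s b := by
  rw [lowDeriv, lowDeriv]
  congr 1
  refine List.filter_congr fun x hx => ?_
  have := h x hx
  rw [decide_eq_decide]
  omega

/-- Both exchanged labels are differentiated, and all labels above `b` are fixed. -/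
theorem lowDeriv_map_swap (na : ℝ) {s : List ℕ} (hs : s.Nodup) (h0 : 0 < s.length) {a b : ℕ}
    (hab : a < b) :
    lowDeriv na (s.map (Equiv.swap a b)) (b + 1) = lowDeriv na s (b + 1) := by
  have hfix : ∀ x, b + 1 ≤ x → Equiv.swap a b x = x := fun x hx =>
    Equiv.swap_apply_of_ne_of_ne (by omega) (by omega)
  rw [lowDeriv_map na (c := b + 1) (hs.map (Equiv.injective _)) h0]
  · exact ((loopValue_multiAffine na hs h0).lowDeriv _).rename_eq_self fun i hi =>
      hfix i (Finset.mem_filter.mp hi).2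
  · intro x _
    rw [Equiv.swap_apply_def]
    split_ifs <;> omega
  · intro x _ y _ h1 h2
    rwa [hfix x h1, hfix y (by omega)]

theorem map_swap_eq {a b : ℕ} {u v : List ℕ} (h : (a :: u ++ b :: v).Nodup) :
    (a :: u ++ b :: v).map (Equiv.swap a b) = b :: u ++ a :: v := by
  have hid : ∀ l : List ℕ, a ∉ l → b ∉ l → l.map (Equiv.swap a b) = l := by
    intro l ha hb
    refine (List.map_congr_left fun x hx => ?_).trans (List.map_id l)
    exact Equiv.swap_apply_of_ne_of_ne (fun h => ha (h ▸ hx)) (fun h => hb (h ▸ hx))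
  simp only [List.nodup_append, List.nodup_cons, List.mem_cons] at h
  obtain ⟨⟨h1, h2⟩, ⟨h3, h4⟩, h5⟩ := h
  rw [List.map_append, List.map_cons, List.map_cons, Equiv.swap_apply_left,
    Equiv.swap_apply_right, hid u h1 fun hb => h5 b (Or.inr hb) b (Or.inl rfl) rfl,
    hid v (fun ha => h5 a (Or.inl rfl) a (Or.inr ha) rfl) h3]

/-- The derivative of the sum of the cuts at `a`, along the next label `b`, for the loop with `a`
and `b` exchanged. -/
theorem pderiv_holeAt_swap (na : ℝ) {w : List ℕ} (hw : w.Nodup) {a b : ℕ} (ha : a ∈ w)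
    (hb : b ∈ w) (hab : a < b) (hgap : ∀ c ∈ w, c ≤ a ∨ b ≤ c) :
    pderiv b (holeAt na (w.map (Equiv.swap a b)) a) = ∑ c ∈ w.toFinset.filter (· < a),
      lowDeriv na (strand w c b) (b + 1) * lowDeriv na (strand w b c) (b + 1) := by
  have hw' : (w.map (Equiv.swap a b)).Nodup := hw.map (Equiv.injective _)
  have hmem : ∀ x, x ∈ w.map (Equiv.swap a b) ↔ x ∈ w := by
    intro x
    rw [List.mem_map]
    constructor
    · rintro ⟨y, hy, rfl⟩
      rw [Equiv.swap_apply_def]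
      split_ifs <;> assumption
    · intro hx
      refine ⟨Equiv.swap a b x, ?_, by simp⟩
      rw [Equiv.swap_apply_def]
      split_ifs <;> assumption
  have hfs : (w.map (Equiv.swap a b)).toFinset = w.toFinset := by
    ext x
    rw [List.mem_toFinset, List.mem_toFinset, hmem]
  rw [holeAt, hfs, map_sum]
  refine Finset.sum_congr rfl fun c hc => ?_
  rw [Finset.mem_filter, List.mem_toFinset] at hc
  obtain ⟨hc, hca⟩ := hc
  have hcw := (hmem c).mpr hc
  have haw := (hmem a).mpr ha
  have hbw := (hmem b).mpr hb
  have hsc : Equiv.swap a b c = c := Equiv.swap_apply_of_ne_of_ne (by omega) (by omega)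
  have hs1 : strand (w.map (Equiv.swap a b)) c a = (strand w c b).map (Equiv.swap a b) := by
    rw [← strand_map hw' hc hb (by omega), hsc, Equiv.swap_apply_right]
  have hs2 : strand (w.map (Equiv.swap a b)) a c = (strand w b c).map (Equiv.swap a b) := by
    rw [← strand_map hw' hb hc (by omega), hsc, Equiv.swap_apply_right]
  have hg : ∀ x y, x ∈ w.map (Equiv.swap a b) → y ∈ w.map (Equiv.swap a b) → x ≠ y →
      lowDeriv na (strand (w.map (Equiv.swap a b)) x y) (a + 1) =
        lowDeriv na (strand (w.map (Equiv.swap a b)) x y) b := by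
    intro x y hx hy hxy
    exact lowDeriv_of_gap na hab fun z hz =>
      hgap z ((hmem z).mp (mem_of_mem_strand hw' hx hy hxy hz))
  have hin : ∀ x y, x ∈ w.map (Equiv.swap a b) → y ∈ w.map (Equiv.swap a b) → x ≠ y →
      b ∈ strand (w.map (Equiv.swap a b)) x y →
      pderiv b (lowDeriv na (strand (w.map (Equiv.swap a b)) x y) b) =
        lowDeriv na (strand (w.map (Equiv.swap a b)) x y) (b + 1) := fun x y hx hy hxy h =>
    pderiv_lowDeriv_of_mem na (strand_nodup hw' hx hy hxy) h
  have hout : ∀ x y, x ∈ w.map (Equiv.swap a b) → y ∈ w.map (Equiv.swap a b) → x ≠ y →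
      b ∉ strand (w.map (Equiv.swap a b)) x y →
      pderiv b (lowDeriv na (strand (w.map (Equiv.swap a b)) x y) b) = 0 := by
    intro x y hx hy hxy h
    refine ((loopValue_multiAffine na (strand_nodup hw' hx hy hxy)
      (length_strand_pos hw' hx hy hxy)).lowDeriv b b).2 ?_
    simp [h]
  -- The label `b` lies on exactly one of the two strands, so one Leibniz term survives; the
  -- threshold can first be moved from `a + 1` to `b` because no label lies strictly between.
  have hres : pderiv b (lowDeriv na (strand (w.map (Equiv.swap a b)) c a) (a + 1) *
      lowDeriv na (strand (w.map (Equiv.swap a b)) a c) (a + 1)) =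
      lowDeriv na (strand (w.map (Equiv.swap a b)) c a) (b + 1) *
      lowDeriv na (strand (w.map (Equiv.swap a b)) a c) (b + 1) := by
    rw [hg c a hcw haw (by omega), hg a c haw hcw (by omega), pderiv_mul]
    rcases mem_strand_or hw' hcw haw (by omega) hbw with h | h
    · have h' := notMem_strand hw' hcw haw (by omega) h
      rw [hin c a hcw haw (by omega) h, hout a c haw hcw (by omega) h',
        lowDeriv_of_notMem na h', mul_zero, add_zero]
    · have h' := notMem_strand hw' haw hcw (by omega) h
      rw [hin a c haw hcw (by omega) h, hout c a hcw haw (by omega) h',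
        lowDeriv_of_notMem na h', zero_mul, zero_add]
  rw [hres, hs1, hs2, lowDeriv_map_swap na (strand_nodup hw hc hb (by omega))
    (length_strand_pos hw hc hb (by omega)) hab, lowDeriv_map_swap na
    (strand_nodup hw hb hc (by omega)) (length_strand_pos hw hb hc (by omega)) hab]

/-! ### The expansion coefficients of a stationary family -/

namespace IsStationary

variable {na : ℝ} {E : Cycle ℕ → MvPolynomial ℕ ℝ} (hE : IsStationary na E)

include hE

theorem atZero_pderiv {a b : ℕ} {u v : List ℕ} (hw : (a :: u ++ b :: v).Nodup) (hab : a < b)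
    (hgap : ∀ c ∈ u ++ v, c < a ∨ b < c) :
    atZero b (pderiv a (E ((a :: u ++ b :: v : List ℕ) : Cycle ℕ))) =
      atZero a (pderiv b (E ((b :: u ++ a :: v : List ℕ) : Cycle ℕ))) +
        pderiv a (E ((a :: u : List ℕ) : Cycle ℕ)) * pderiv b (E ((b :: v : List ℕ) : Cycle ℕ)) := by
  have hw' : (b :: u ++ a :: v).Nodup := by
    rw [← map_swap_eq hw]
    exact hw.map (Equiv.injective _)
  refine atZero_pderiv_eq_of_gluing hab.ne (hE.harmonic _ (by simp) hw)
    (hE.harmonic _ (by simp) hw') (hE.continuity a b u v hw hab hgap) ?_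
  rw [hE.gluing a b u v hw hab hgap, mul_assoc]

/-- Induction on the number of labels below `b`. Gluing at the preceding label `a` produces the cut
at `a`; the remaining term is the datum at `a` for the exchanged loop, whose derivative along `b`
supplies the cuts below `a` by `pderiv_holeAt_swap`. -/
theorem atZero_derivs {w : List ℕ} (hw : w.Nodup) (h2 : 2 ≤ w.length)
    (hlt : ∀ s : List ℕ, s.Nodup → 0 < s.length → s.length < w.length →
      E (s : Cycle ℕ) = loopValue na s) {b : ℕ} (hb : b ∈ w) :
    atZero b (derivs (w.filter (· < b)) (E (w : Cycle ℕ))) = holeAt na w b := by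
  induction hr : (w.toFinset.filter (· < b)).card generalizing w b with
  | zero =>
    have he := Finset.card_eq_zero.mp hr
    have hmin : ∀ c ∈ w, b ≤ c := fun c hc => not_lt.mp fun h =>
      Finset.notMem_empty c (he ▸ Finset.mem_filter.mpr ⟨List.mem_toFinset.mpr hc, h⟩)
    have h1 := hE.left_boundary w h2 hw b hb hmin
    rw [aeval_update_eq (hE.harmonic w (List.ne_nil_of_mem hb) hw b), zero_mul, add_zero] at h1
    rw [List.filter_eq_nil_iff.mpr (by simpa using hmin), derivs_nil, h1, holeAt, he,
      Finset.sum_empty]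
  | succ r ih =>
    -- The chosen `a` is the largest label below `b`, hence its neighbour on the chain.
    obtain ⟨a, ha, hmax⟩ := (w.toFinset.filter (· < b)).exists_max_image id
      (Finset.card_pos.mp (by omega))
    simp only [Finset.mem_filter, List.mem_toFinset, id, and_imp] at ha hmax
    obtain ⟨ha, hab⟩ := ha
    have hgap : ∀ c ∈ w, c ≤ a ∨ b ≤ c := fun c hc => by
      by_cases h : c < b
      · exact Or.inl (hmax c hc h)
      · exact Or.inr (not_lt.mp h)
    obtain ⟨u, v, h, hs1, hs2⟩ := exists_strand hw ha hb hab.ne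
    have hEw : E (w : Cycle ℕ) = E ((a :: u ++ b :: v : List ℕ) : Cycle ℕ) :=
      congrArg E (Cycle.coe_eq_coe.mpr h)
    have hn := h.nodup_iff.mp hw
    have hm : ((a :: u ++ b :: v).map (Equiv.swap a b)) = b :: u ++ a :: v := map_swap_eq hn
    have hrot : w.map (Equiv.swap a b) ~r b :: u ++ a :: v := hm ▸ h.map _
    have hw' : (w.map (Equiv.swap a b)).Nodup := hw.map (Equiv.injective _)
    have hEw' : E ((w.map (Equiv.swap a b) : List ℕ) : Cycle ℕ) =
        E ((b :: u ++ a :: v : List ℕ) : Cycle ℕ) :=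
      congrArg E (Cycle.coe_eq_coe.mpr hrot)
    have hperm : (w.map (Equiv.swap a b)).Perm w := by
      refine (List.perm_ext_iff_of_nodup hw' hw).mpr fun x => ?_
      rw [hrot.mem_iff, h.mem_iff]
      simp only [List.mem_append, List.mem_cons]
      tauto
    have hfil : w.filter (· < b) = w.filter (· < a + 1) := List.filter_congr fun x hx => by
      have := hgap x hx
      rw [decide_eq_decide]
      omega
    have hins : w.toFinset.filter (· < b) = insert a (w.toFinset.filter (· < a)) := by
      ext x
      simp only [Finset.mem_filter, List.mem_toFinset, Finset.mem_insert]
      constructor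
      · rintro ⟨hx, hxb⟩
        have := hgap x hx
        by_cases hxa : x = a
        · exact Or.inl hxa
        · exact Or.inr ⟨hx, by omega⟩
      · rintro (rfl | ⟨hx, hxa⟩)
        · exact ⟨ha, hab⟩
        · exact ⟨hx, by omega⟩
    have hcard : ((w.map (Equiv.swap a b)).toFinset.filter (· < a)).card = r := by
      rw [List.toFinset_eq_of_perm _ _ hperm]
      rw [hins, Finset.card_insert_of_notMem (by simp)] at hr
      omega
    have IH := ih hw' (by simpa using h2) (by simpa using hlt) (hperm.mem_iff.mpr ha) hcard
    rw [derivs_perm (hperm.filter _), hEw'] at IH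
    have hal : a ∉ w.filter (· < a) := by simp
    have hbl : b ∉ w.filter (· < a) := by
      simp only [List.mem_filter, decide_eq_true_eq]
      omega
    have hgap' : ∀ c ∈ u ++ v, c < a ∨ b < c := by
      intro c hc
      have h1 := hgap c (h.mem_iff.mpr (by
        simp only [List.mem_append, List.mem_cons] at hc ⊢
        tauto))
      simp only [List.nodup_append, List.nodup_cons, List.mem_cons] at hn
      obtain ⟨⟨h3, h4⟩, ⟨h5, h6⟩, h7⟩ := hn
      have hca : c ≠ a := by
        rintro rfl
        rcases List.mem_append.mp hc with h8 | h8
        · exact h3 h8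
        · exact h7 c (Or.inl rfl) c (Or.inr h8) rfl
      have hcb : c ≠ b := by
        rintro rfl
        rcases List.mem_append.mp hc with h8 | h8
        · exact h7 c (Or.inr h8) c (Or.inl rfl) rfl
        · exact h5 h8
      omega
    have hlen := h.perm.length_eq
    simp only [List.length_append, List.length_cons] at hlen
    -- The derivatives along `a` and `b` are already present, so those along the labels below `a`
    -- complete both factors to derivatives along all labels up to `b`.
    have hsplit : derivs (w.filter (· < a)) (pderiv a (E ((a :: u : List ℕ) : Cycle ℕ)) *
        pderiv b (E ((b :: v : List ℕ) : Cycle ℕ))) =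
        lowDeriv na (a :: u) (b + 1) * lowDeriv na (b :: v) (b + 1) := by
      have hl : ∀ l : List ℕ, (∀ c ∈ l, c ∈ u ++ v) → l.filter (· < b + 1) = l.filter (· < a) :=
        fun l hl => List.filter_congr fun c hc => by
          have := hgap' c (hl c hc)
          rw [decide_eq_decide]
          omega
      have hu := hn.of_append_left
      have hv := hn.of_append_right
      have hdisj := List.disjoint_of_nodup_append hn
      rw [hlt (a :: u) hu (by simp) (by simp; omega),
        hlt (b :: v) hv (by simp) (by simp; omega), lowDeriv, lowDeriv,
        List.filter_cons_of_pos (by simp; omega), List.filter_cons_of_pos (by simp),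
        hl u (by simp +contextual), hl v (by simp +contextual), derivs_cons, derivs_cons]
      refine derivs_mul_of_perm ?_ ?_ ?_
      · refine (h.perm.filter _).trans ?_
        rw [List.filter_append, List.filter_cons_of_neg (by simp),
          List.filter_cons_of_neg (by simp; omega)]
      · intro i hi
        refine ((loopValue_multiAffine na hu (by simp)).pderiv a i).2 fun h' => ?_
        rw [Finset.mem_erase, List.mem_toFinset] at h'
        exact hdisj h'.2 (List.mem_cons_of_mem _ (List.mem_of_mem_filter hi))
      · intro i hi
        refine ((loopValue_multiAffine na hv (by simp)).pderiv b i).2 fun h' => ?_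
        rw [Finset.mem_erase, List.mem_toFinset] at h'
        exact hdisj (List.mem_cons_of_mem _ (List.mem_of_mem_filter hi)) h'.2
    rw [hfil, derivs_perm (filter_lt_succ_perm hw ha), derivs_cons, ← derivs_atZero hbl, hEw,
      hE.atZero_pderiv hn hab hgap', derivs_add, hsplit, ← pderiv_atZero_of_ne hab.ne,
      ← pderiv_derivs, derivs_atZero hal, IH, pderiv_holeAt_swap na hw ha hb hab hgap, holeAt,
      hins, Finset.sum_insert (by simp), hs1, hs2, add_comm]

/-- At the largest label the value at zero and the derivative add up to the value at one, which the
right boundary condition makes zero. -/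
theorem derivs_eq_neg_holeAt {w : List ℕ} (hw : w.Nodup) (h2 : 2 ≤ w.length)
    (hlt : ∀ s : List ℕ, s.Nodup → 0 < s.length → s.length < w.length →
      E (s : Cycle ℕ) = loopValue na s) {b : ℕ} (hb : b ∈ w) (hl : ∀ x ∈ w, x ≤ b) :
    derivs w (E (w : Cycle ℕ)) = -holeAt na w b := by
  have h1 := hE.right_boundary w h2 hw b hb hl
  rw [aeval_update_eq (hE.harmonic w (List.ne_nil_of_mem hb) hw b), one_mul] at h1
  have h3 := congrArg (derivs (w.filter (· < b))) h1
  rw [derivs_add, derivs_atZero (by simp), hE.atZero_derivs hw h2 hlt hb, derivs_zero,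
    ← derivs_cons, ← derivs_perm (filter_lt_succ_perm hw hb), List.filter_eq_self.mpr] at h3
  · linear_combination h3
  · intro x hx
    simpa [Nat.lt_succ_iff] using hl x hx

theorem eq_loopValue {w : List ℕ} (hw : w.Nodup) (h0 : 0 < w.length) :
    E (w : Cycle ℕ) = loopValue na w := by
  induction hm : w.length using Nat.strong_induction_on generalizing w with
  | _ m ih =>
    subst hm
    by_cases h1 : w.length = 1
    · obtain ⟨i, rfl⟩ := List.length_eq_one_iff.mp h1
      rw [loopValue_singleton, hE.one_point]
    have h2 : 2 ≤ w.length := by omega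
    have hlt : ∀ s : List ℕ, s.Nodup → 0 < s.length → s.length < w.length →
        E (s : Cycle ℕ) = loopValue na s := fun s hs hs0 hsw => ih _ hsw hs hs0 rfl
    rw [← sub_eq_zero]
    have hp : (w.insertionSort (· ≤ ·)).Perm w := List.perm_insertionSort _ w
    -- The difference from the loop value is expanded along the labels in increasing order, so that
    -- each prefix is the set of labels below the next one.
    apply eq_zero_of_derivs_atZero (w.insertionSort (· ≤ ·))
    · intro l₁ b l₂ hl
      have hsort : (l₁ ++ b :: l₂).Pairwise (· ≤ ·) := by
        rw [← hl]
        exact List.pairwise_insertionSort _ _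
      have hn : (l₁ ++ b :: l₂).Nodup := by
        rw [← hl]
        exact hp.nodup_iff.mpr hw
      have hmem : ∀ x, x ∈ l₁ ++ b :: l₂ ↔ x ∈ w := fun x => by
        rw [← hl]
        exact hp.mem_iff
      have hb : b ∈ w := (hmem b).mp (by simp)
      rw [List.pairwise_append, List.pairwise_cons] at hsort
      have hl₁ : l₁.Perm (w.filter (· < b)) := by
        refine (List.perm_ext_iff_of_nodup hn.of_append_left (hw.filter _)).mpr fun x => ?_
        rw [List.mem_filter, ← hmem, decide_eq_true_eq, List.mem_append, List.mem_cons]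
        constructor
        · intro hx
          refine ⟨Or.inl hx, lt_of_le_of_ne (hsort.2.2 x hx b (by simp)) ?_⟩
          rintro rfl
          exact List.disjoint_of_nodup_append hn hx (by simp)
        · rintro ⟨hx | rfl | hx, hxb⟩
          · exact hx
          · omega
          · have := hsort.2.1.1 x hx
            omega
      rw [derivs_sub, atZero_sub, derivs_perm hl₁, derivs_perm hl₁,
        hE.atZero_derivs hw h2 hlt hb, sub_eq_zero, atZero, ← lowDeriv,
        pderiv_lowDeriv_of_mem na hw hb, lowDeriv_eq_holeAt_add na hw h2 hb]
      ring
    · obtain ⟨b, hb, hl⟩ := exists_last h0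
      rw [derivs_sub, derivs_perm hp, derivs_perm hp, hE.derivs_eq_neg_holeAt hw h2 hlt hb hl,
        ← (goodBelow na _).lowDeriv_eq_neg_holeAt hw h2 hb hl (Nat.lt_succ_self b), lowDeriv,
        List.filter_eq_self.mpr, sub_self]
      intro x hx
      simpa [Nat.lt_succ_iff] using hl x hx

end IsStationary

/-! ### Ranks and relabellings -/

theorem length_filter_lt_of_mem {e : List ℕ} {p q : ℕ → Bool} (hpq : ∀ x ∈ e, p x → q x) {v : ℕ}
    (hv : v ∈ e) (hp : ¬p v) (hq : q v) : (e.filter p).length < (e.filter q).length := by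
  induction e with
  | nil => simp at hv
  | cons a e ih =>
    rw [List.forall_mem_cons] at hpq
    have hle : (e.filter p).length ≤ (e.filter q).length := by
      rw [← List.countP_eq_length_filter, ← List.countP_eq_length_filter]
      exact List.countP_mono_left hpq.2
    rcases List.mem_cons.mp hv with rfl | hv'
    · rw [List.filter_cons_of_neg hp, List.filter_cons_of_pos hq, List.length_cons]
      omega
    · have := ih hpq.2 hv'
      by_cases h1 : p a
      · rw [List.filter_cons_of_pos h1, List.filter_cons_of_pos (hpq.1 h1)]
        simpa using this
      · rw [List.filter_cons_of_neg h1]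
        by_cases h2 : q a
        · rw [List.filter_cons_of_pos h2, List.length_cons]
          omega
        · rwa [List.filter_cons_of_neg h2]

theorem length_filter_mono {e : List ℕ} {p q : ℕ → Bool} (hpq : ∀ x ∈ e, p x → q x) :
    (e.filter p).length ≤ (e.filter q).length := by
  rw [← List.countP_eq_length_filter, ← List.countP_eq_length_filter]
  exact List.countP_mono_left hpq

theorem length_filter_le_lt {e : List ℕ} {v v' : ℕ} (hv' : v' ∈ e) (h : v < v') :
    (e.filter (· ≤ v)).length < (e.filter (· ≤ v')).length := by
  refine length_filter_lt_of_mem (v := v') ?_ hv' ?_ ?_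
  · intro x _
    simp only [decide_eq_true_eq]
    omega
  · simpa using h
  · simp

theorem length_filter_add_not (e : List ℕ) (M : ℕ) :
    (e.filter (· ≤ M)).length + (e.filter (M < ·)).length = e.length := by
  induction e with
  | nil => rfl
  | cons a e ih =>
    by_cases h : a ≤ M
    · rw [List.filter_cons_of_pos (by simpa using h), List.filter_cons_of_neg (by simpa using h),
        List.length_cons, List.length_cons]
      omega
    · rw [List.filter_cons_of_neg (by simpa using h),
        List.filter_cons_of_pos (by simpa using h), List.length_cons, List.length_cons]
      omega

theorem isDeformation_standardize {e : List ℕ} (he : e.Nodup) :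
    IsDeformation (standardize e) := by
  have hlen : (standardize e).length = e.length := List.length_map _
  have hn : (standardize e).Nodup := by
    refine he.map_on fun x hx y hy h => ?_
    by_contra hxy
    rcases lt_or_gt_of_ne hxy with h' | h'
    · exact (length_filter_le_lt hy h').ne h
    · exact (length_filter_le_lt hx h').ne' h
  refine List.Subperm.perm_of_length_le (hn.subperm fun x hx => ?_) (by simp)
  rw [standardize, List.mem_map] at hx
  obtain ⟨v, hv, rfl⟩ := hx
  rw [hlen, List.mem_range'_1]
  have h1 : 0 < (e.filter (· ≤ v)).length := List.length_pos_of_mem (a := v) (by simpa using hv)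
  have h2 := List.length_filter_le (· ≤ v) e
  omega

theorem mem_deformation {μ : List ℕ} (hμ : IsDeformation μ) {x : ℕ} :
    x ∈ μ ↔ 1 ≤ x ∧ x ≤ μ.length := by
  rw [hμ.mem_iff, List.mem_range'_1]
  omega

theorem IsDeformation.nodup {μ : List ℕ} (hμ : IsDeformation μ) : μ.Nodup :=
  hμ.nodup_iff.mpr List.nodup_range'

/-- In the decreasing list of floating labels, `v` is preceded exactly by the entries larger than
it. -/
theorem floating_getD {e : List ℕ} (he : e.Nodup) {M s v : ℕ} (hs : ∀ x ∈ e, x ≤ s) (hv : v ∈ e)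
    (hM : M < v) : (floating e M s).getD (e.filter (v < ·)).length 0 = v := by
  have hp : (floating e M s).Perm (e.filter fun j => M + 1 ≤ j ∧ j ≤ s) :=
    List.perm_insertionSort _ _
  have hn : (floating e M s).Nodup := hp.nodup_iff.mpr (he.filter _)
  have hsort : (floating e M s).Pairwise (· ≥ ·) := List.pairwise_insertionSort _ _
  have hmem : v ∈ floating e M s := by
    rw [hp.mem_iff, List.mem_filter, decide_eq_true_eq]
    exact ⟨hv, hM, hs v hv⟩
  have hlen : (e.filter (v < ·)).length = ((floating e M s).filter (v < ·)).length := by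
    rw [(hp.filter _).length_eq, List.filter_filter]
    congr 1
    refine List.filter_congr fun x hx => ?_
    have := hs x hx
    rw [Bool.eq_iff_iff, Bool.and_eq_true, decide_eq_true_eq, decide_eq_true_eq]
    omega
  rw [hlen]
  generalize floating e M s = F at *
  obtain ⟨l, r, rfl⟩ := List.append_of_mem hmem
  rw [List.pairwise_append, List.pairwise_cons] at hsort
  have hl : (l ++ v :: r).filter (v < ·) = l := by
    rw [List.filter_append, List.filter_cons_of_neg (by simp), List.filter_eq_self.mpr,
      List.filter_eq_nil_iff.mpr, List.append_nil]
    · intro x hx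
      simpa using hsort.2.1.1 x hx
    · intro x hx
      rw [decide_eq_true_eq]
      refine lt_of_le_of_ne (hsort.2.2 x hx v (by simp)) ?_
      rintro rfl
      exact List.disjoint_of_nodup_append hn hx (by simp)
  rw [hl]
  simp

theorem omegaCycle_apply_of_lt {l M x : ℕ} (hx : M < x) : omegaCycle l M x = x := by
  refine List.formPerm_apply_of_notMem ?_
  rw [List.mem_range'_1]
  omega

theorem omegaCycle_le_iff {l M x : ℕ} : omegaCycle l M x ≤ M ↔ x ≤ M := by
  have h : ∀ x, x ≤ M → omegaCycle l M x ≤ M := by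
    intro x hx
    by_cases hm : x ∈ List.range' l (M + 1 - l)
    · have := List.formPerm_apply_mem_of_mem hm
      rw [List.mem_range'_1] at this hm
      rw [omegaCycle]
      omega
    · rwa [omegaCycle, List.formPerm_apply_of_notMem hm]
  refine ⟨fun h' => ?_, h x⟩
  by_contra hx
  rw [omegaCycle_apply_of_lt (by omega)] at h'
  exact hx h'

theorem length_floating_map {e : List ℕ} {l M s : ℕ} (hs : ∀ x ∈ e, x ≤ s) :
    (floating (e.map (omegaCycle l M)) M s).length = (e.filter (M < ·)).length := by
  rw [floating, List.length_insertionSort, List.filter_map, List.length_map]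
  congr 1
  refine List.filter_congr fun x hx => ?_
  have h1 := hs x hx
  rw [Function.comp_apply, decide_eq_decide, Nat.succ_le_iff, ← not_le, omegaCycle_le_iff, not_le]
  refine ⟨fun h => h.1, fun h => ⟨h, ?_⟩⟩
  rwa [omegaCycle_apply_of_lt h]

/-! ### Deformed loops -/

/-- The loop of `μ` preceded by `N` points and followed by `κ` points. -/
def paddedLoop (μ : List ℕ) (N κ : ℕ) : List ℕ :=
  List.range' 1 N ++ μ.map (· + N) ++ List.range' (N + μ.length + 1) κ

theorem deformedLoop_eq (μ : List ℕ) (N κ : ℕ) :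
    deformedLoop μ (N + 1) (N + κ + μ.length) = paddedLoop μ N κ := by
  rw [deformedLoop, paddedLoop, show N + κ + μ.length + 1 - (N + 1 + μ.length) = κ by omega,
    show N + 1 + μ.length = N + μ.length + 1 by omega]
  rfl

theorem paddedLoop_perm {μ : List ℕ} (hμ : IsDeformation μ) (N κ : ℕ) :
    (paddedLoop μ N κ).Perm (List.range' 1 (N + κ + μ.length)) := by
  have h1 : (μ.map (· + N)).Perm (List.range' (1 + N) μ.length) := by
    have := List.Perm.map (· + N) hμ
    refine this.trans (List.Perm.of_eq ?_)
    have h2 : (fun x => x + N) = fun x : ℕ => N + x := by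
      funext x
      exact add_comm _ _
    rw [h2, List.map_add_range', add_comm N 1]
  rw [show N + κ + μ.length = N + μ.length + κ by ring, ← List.range'_append_1,
    ← List.range'_append_1, paddedLoop, show N + μ.length + 1 = 1 + (N + μ.length) by ring]
  exact (h1.append_left _).append_right _

theorem paddedLoop_nodup {μ : List ℕ} (hμ : IsDeformation μ) (N κ : ℕ) :
    (paddedLoop μ N κ).Nodup :=
  (paddedLoop_perm hμ N κ).nodup_iff.mpr List.nodup_range'

theorem length_paddedLoop (μ : List ℕ) (N κ : ℕ) :
    (paddedLoop μ N κ).length = N + κ + μ.length := by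
  simp [paddedLoop]
  ring

theorem mem_paddedLoop {μ : List ℕ} (hμ : IsDeformation μ) {N κ x : ℕ} :
    x ∈ paddedLoop μ N κ ↔ 1 ≤ x ∧ x ≤ N + κ + μ.length := by
  rw [(paddedLoop_perm hμ N κ).mem_iff, List.mem_range'_1]
  omega

theorem derivs_range'_eq_lowDeriv (na : ℝ) {w : List ℕ} {P q : ℕ}
    (hw : w.Perm (List.range' 1 P)) (hq : q ≤ P) :
    derivs (List.range' 1 q) (loopValue na w) = lowDeriv na w (q + 1) := by
  refine derivs_perm ?_ _
  refine (List.perm_ext_iff_of_nodup List.nodup_range'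
    ((hw.nodup_iff.mpr List.nodup_range').filter _)).mpr fun x => ?_
  rw [List.mem_filter, hw.mem_iff, List.mem_range'_1, List.mem_range'_1, decide_eq_true_eq]
  omega

theorem coeff_hatD (na : ℝ) {μ : List ℕ} (hμ : IsDeformation μ) {k p : ℕ} (hp : p ≤ μ.length)
    (N : ℕ) : PowerSeries.coeff N (hatD na μ k p) =
      rename (fun j => N + k + μ.length - j)
        (lowDeriv na (paddedLoop μ N k) (N + μ.length - p + 1)) := by
  rw [hatD, PowerSeries.coeff_mk, coefC, deformedLoop_eq,
    derivs_range'_eq_lowDeriv na (paddedLoop_perm hμ N k) (by omega),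
    show N + k + μ.length - (k + p) = N + μ.length - p by omega]

/-- The value at `X b = 0` of the derivative of a loop along the labels smaller than `b`. -/
theorem coefS_eq_holeAt (na : ℝ) {μ : List ℕ} (hμ : IsDeformation μ) {N k p M : ℕ}
    (hp : p < μ.length) (hM : M = μ.length - p) (h2 : 2 ≤ N + k + μ.length) :
    coefS na μ (N + 1) (N + k + μ.length) (k + p) =
      rename (fun j => N + k + μ.length - j) (holeAt na (paddedLoop μ N k) (N + M)) := by
  have hw := paddedLoop_nodup hμ N k
  have hb : N + M ∈ paddedLoop μ N k := by
    rw [mem_paddedLoop hμ]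
    omega
  have hlen : 2 ≤ (paddedLoop μ N k).length := by rwa [length_paddedLoop]
  have hMA := (loopValue_multiAffine na hw (by omega)).lowDeriv (N + M)
  rw [coefS, deformedLoop_eq, derivs_range'_eq_lowDeriv na (paddedLoop_perm hμ N k) (by omega),
    show N + k + μ.length - (k + p) = N + M by omega,
    show N + M - 1 + 1 = N + M by omega,
    aeval_update_eq (hMA _).1, zero_mul, add_zero, atZero, pderiv_lowDeriv_of_mem na hw hb,
    lowDeriv_eq_holeAt_add na hw hlen hb, add_sub_cancel_right]

theorem map_idxOf_eq_range' {A : List ℕ} (hA : A.Nodup) :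
    A.map (fun x => A.idxOf x + 1) = List.range' 1 A.length := by
  refine List.ext_getElem (by simp) fun i h1 h2 => ?_
  rw [List.getElem_map, List.getElem_range', hA.idxOf_getElem]
  ring

/-- The loop with initial block `A` is a relabelling of the padded loop of the standardized
extraction with `A.length` initial points. Inside `A` the relabelling need not be monotone, nor on
entries up to `M`: all these labels are differentiated. Hence `ω` enters only through `hω` and
`hω'`. -/
theorem coeff_hatDExt (na : ℝ) {s M k κ N : ℕ} {A e : List ℕ} {ω : Equiv.Perm ℕ}
    (hMs : M ≤ s) (hκ : κ = 0 ∨ κ = k) (hω : ∀ x, M < x → ω x = x)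
    (hω' : ∀ x, ω x ≤ M ↔ x ≤ M) (he : ∀ x ∈ e, x ≤ s) (hA : ∀ x ∈ A, x ≤ N + M)
    (hn : (A ++ e.map (· + N) ++ List.range' (N + s + 1) κ).Nodup)
    (h0 : 0 < A.length + e.length) :
    PowerSeries.coeff A.length (hatDExt na s M k (e.map ω) κ) =
      rename (fun j => N + k + s - j)
        (lowDeriv na (A ++ e.map (· + N) ++ List.range' (N + s + 1) κ) (N + M + 1)) := by
  have hAn : A.Nodup := hn.of_append_left.of_append_left
  have hen : e.Nodup := hn.of_append_left.of_append_right.of_map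
  have heω : (e.map ω).Nodup := hen.map ω.injective
  have hsω : ∀ x ∈ e.map ω, x ≤ s := by
    intro x hx
    obtain ⟨y, hy, rfl⟩ := List.mem_map.mp hx
    by_cases h : y ≤ M
    · exact ((hω' y).mpr h).trans hMs
    · rw [hω y (by omega)]
      exact he y hy
  set f : List ℕ := e.map ω with hf
  have hfl : f.length = e.length := List.length_map _
  have hstd : (standardize f).length = e.length := by rw [standardize, List.length_map, hfl]
  have hfloat : (floating f M s).length = (f.filter (M < ·)).length := by
    rw [floating, List.length_insertionSort]
    congr 1
    refine List.filter_congr fun x hx => ?_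
    have := hsω x hx
    rw [decide_eq_decide]
    omega
  have hcount := length_filter_add_not f M
  set L : List ℕ := A ++ e.map (· + N) ++ List.range' (N + s + 1) κ with hL
  -- Three blocks: points of `A` go to their position, points of the extraction to their rank after
  -- `ω`, shifted past `A`, and the trailing points are renumbered in order.
  set g : ℕ → ℕ := fun x => if x ∈ A then A.idxOf x + 1
    else if x ≤ N + s then (f.filter (· ≤ ω (x - N))).length + A.length
    else x - (N + s) + (A.length + e.length) with hg
  have hgA : ∀ x ∈ A, g x = A.idxOf x + 1 := fun x hx => if_pos hx
  have hge : ∀ y ∈ e, g (y + N) = (f.filter (· ≤ ω y)).length + A.length := by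
    intro y hy
    have h1 : y + N ∉ A := fun h => List.disjoint_of_nodup_append hn.of_append_left h
      (List.mem_map_of_mem hy)
    have h2 := he y hy
    simp only [hg]
    rw [if_neg h1, if_pos (by omega), Nat.add_sub_cancel]
  have hgt : ∀ x, N + s + 1 ≤ x → g x = x - (N + s) + (A.length + e.length) := by
    intro x hx
    have h1 : x ∉ A := fun h => by
      have := hA x h
      omega
    simp only [hg]
    rw [if_neg h1, if_neg (by omega)]
  have hmap : L.map g = paddedLoop (standardize f) A.length κ := by
    rw [hL, paddedLoop, List.map_append, List.map_append]
    congr 1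
    · congr 1
      · rw [← map_idxOf_eq_range' hAn]
        exact List.map_congr_left hgA
      · rw [standardize, hf, List.map_map, List.map_map, List.map_map]
        exact List.map_congr_left hge
    · rw [hstd]
      refine List.ext_getElem (by simp) fun i h1 h2 => ?_
      rw [List.getElem_map, List.getElem_range', List.getElem_range', hgt _ (by omega)]
      omega
  have hmemL : ∀ x, x ∈ L ↔ x ∈ A ∨ (∃ y ∈ e, y + N = x) ∨ (N + s + 1 ≤ x ∧ x < N + s + 1 + κ) := by
    intro x
    rw [hL, List.mem_append, List.mem_append, List.mem_map, List.mem_range'_1, or_assoc]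
  -- Entries of `f` up to `M` have smaller ranks than the floating ones, so the threshold becomes
  -- one more than the number of points that are neither floating nor trailing.
  have hlow : ∀ x ∈ L, g x < A.length + e.length - (floating f M s).length + 1 ↔
      x < N + M + 1 := by
    intro x hx
    rcases (hmemL x).mp hx with h | ⟨y, hy, rfl⟩ | ⟨h1, h2⟩
    · have h1 := hA x h
      have h2 : A.idxOf x < A.length := List.idxOf_lt_length_of_mem h
      rw [hgA x h]
      omega
    · rw [hge y hy]
      have hyf : ω y ∈ f := List.mem_map_of_mem hy
      have h2 := hω' y
      by_cases h1 : y ≤ M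
      · have h3 : (f.filter (· ≤ ω y)).length ≤ (f.filter (· ≤ M)).length :=
          length_filter_mono fun x _ => by
            simp only [decide_eq_true_eq]
            omega
        omega
      · have h3 := length_filter_le_lt hyf (show M < ω y by omega)
        omega
    · rw [hgt x h1]
      omega
  have hmono : ∀ x ∈ L, ∀ y ∈ L, N + M + 1 ≤ x → x < y → g x < g y := by
    intro x hx y hy h1 hxy
    rcases (hmemL x).mp hx with h | ⟨x, hxe, rfl⟩ | ⟨h2, h3⟩
    · have := hA x h
      omega
    · rcases (hmemL y).mp hy with h | ⟨y, hye, rfl⟩ | ⟨h2, h3⟩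
      · have := hA y h
        omega
      · rw [hge x hxe, hge y hye]
        have hyf : ω y ∈ f := List.mem_map_of_mem hye
        have := length_filter_le_lt (v := ω x) hyf (by
          rw [hω x (by omega), hω y (by omega)]
          omega)
        omega
      · rw [hge x hxe, hgt y h2]
        have := List.length_filter_le (· ≤ ω x) f
        omega
    · rw [hgt x h2, hgt y (by omega)]
      omega
  have hdef := isDeformation_standardize heω
  have hL0 : 0 < L.length := by
    rw [hL, List.length_append, List.length_append, List.length_map]
    omega
  have hMA := (loopValue_multiAffine na hn hL0).lowDeriv (N + M + 1)
  rw [hatDExt, PowerSeries.coeff_map, coeff_hatD na hdef (by omega), ← hmap, hstd,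
    lowDeriv_map na (c := N + M + 1) (by
      rw [hmap]
      exact paddedLoop_nodup hdef _ _) hL0 hlow hmono]
  simp only [AlgHom.toRingHom_eq_coe, RingHom.coe_coe]
  rw [rename_rename, rename_rename]
  refine hMA.rename_congr fun x hx => ?_
  rw [Finset.mem_filter, List.mem_toFinset] at hx
  obtain ⟨hx, hxM⟩ := hx
  simp only [Function.comp_apply]
  rcases (hmemL x).mp hx with h | ⟨y, hy, rfl⟩ | ⟨h1, h2⟩
  · have := hA x h
    omega
  · have hy1 : ω y = y := hω y (by omega)
    have hyf : y ∈ f := hy1 ▸ List.mem_map_of_mem hy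
    -- The rank of `y` and the number of larger entries add up to the length, so the index minus `κ`
    -- is the place of `y` in the decreasing list of floating labels.
    have h1 := length_filter_add_not f y
    rw [hge y hy, hy1, if_neg (by omega), show A.length + κ + e.length -
      ((f.filter (· ≤ y)).length + A.length) - κ = (f.filter (y < ·)).length by omega,
      floating_getD heω hsω hyf (by omega)]
    omega
  · rw [hgt x h1]
    rcases hκ with rfl | rfl
    · omega
    · rw [if_pos (by omega)]
      omega

/-! ### Cutting a deformed loop -/

theorem isRotated_of_eq {w w' : List ℕ} (h : w = w') : w ~r w' := h ▸ List.IsRotated.refl w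

section

variable (na : ℝ) {μ : List ℕ} (hμ : IsDeformation μ) (N k : ℕ)

include hμ

theorem IsDeformation.le_length {l : List ℕ} (hl : ∀ x ∈ l, x ∈ μ) : ∀ x ∈ l, x ≤ μ.length :=
  fun x hx => ((mem_deformation hμ).mp (hl x hx)).2

/-- The two loops obtained by cutting at one of the first points and at the point `M` of the
deformation. -/
theorem lowDeriv_cut_before {M : ℕ} {l r : List ℕ} (hlr : μ = l ++ M :: r) {i : ℕ} (hi : 1 ≤ i)
    (hiN : i ≤ N) :
    rename (fun j => N + k + μ.length - j)
        (lowDeriv na (strand (paddedLoop μ N k) i (N + M)) (N + M + 1)) =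
      PowerSeries.coeff (N + 1 - i) (hatDExt na μ.length M k (extLeft μ M) 0) ∧
    rename (fun j => N + k + μ.length - j)
        (lowDeriv na (strand (paddedLoop μ N k) (N + M) i) (N + M + 1)) =
      PowerSeries.coeff i (hatDExt na μ.length M k (extRight μ M) k) := by
  have hM : M ∈ μ := by simp [hlr]
  have hM' := (mem_deformation hμ).mp hM
  have hnl : M ∉ l := fun h => by
    have := hμ.nodup
    rw [hlr] at this
    exact List.disjoint_of_nodup_append this h (by simp)
  have hidx : μ.idxOf M = l.length := by
    rw [hlr, List.idxOf_append_of_notMem hnl, List.idxOf_cons_self, add_zero]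
  have hl : ∀ x ∈ l, x ≤ μ.length := hμ.le_length fun x hx => by simp [hlr, hx]
  have hr : ∀ x ∈ r, x ≤ μ.length := hμ.le_length fun x hx => by simp [hlr, hx]
  have hL : extLeft μ M = l.map (omegaCycle 1 M) := by
    rw [extLeft, hidx]
    simp [hlr]
  have hR : extRight μ M = r.map (omegaCycle 1 M) := by
    rw [extRight, hidx]
    simp [hlr]
  have hw := paddedLoop_nodup hμ N k
  have hmi : i ∈ paddedLoop μ N k := (mem_paddedLoop hμ).mpr (by omega)
  have hmb : N + M ∈ paddedLoop μ N k := (mem_paddedLoop hμ).mpr (by omega)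
  have hrange : List.range' 1 N = List.range' 1 (i - 1) ++ List.range' i (N + 1 - i) := by
    have := List.range'_append_1 (s := 1) (m := i - 1) (n := N + 1 - i)
    rw [show 1 + (i - 1) = i by omega, show i - 1 + (N + 1 - i) = N by omega] at this
    exact this.symm
  have hcons : List.range' i (N + 1 - i) = i :: List.range' (i + 1) (N - i) := by
    rw [show N + 1 - i = N - i + 1 by omega, List.range'_succ]
  have hrot : paddedLoop μ N k ~r (i :: (List.range' (i + 1) (N - i) ++ l.map (· + N))) ++
      (N + M) :: (r.map (· + N) ++ List.range' (N + μ.length + 1) k ++ List.range' 1 (i - 1)) := by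
    have h1 : paddedLoop μ N k = List.range' 1 (i - 1) ++
        ((i :: (List.range' (i + 1) (N - i) ++ l.map (· + N))) ++
          (N + M) :: (r.map (· + N) ++ List.range' (N + μ.length + 1) k)) := by
      rw [paddedLoop, hrange, hcons]
      conv_lhs => rw [show List.map (· + N) μ = l.map (· + N) ++ (M + N) :: r.map (· + N) by
        simp [hlr]]
      simp [add_comm M N]
    rw [h1]
    refine List.isRotated_append.trans (isRotated_of_eq ?_)
    simp
  have hs1 := strand_of_isRotated hw hrot
  have hs2 := strand_of_isRotated hw (hrot.trans List.isRotated_append)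
  have hn1 := strand_nodup hw hmi hmb (by omega)
  have hn2 := strand_nodup hw hmb hmi (by omega)
  constructor
  -- The initial block is `i, …, N`, of length `N + 1 - i`; no trailing point lies on this strand,
  -- whence `κ = 0`.
  · have hE : strand (paddedLoop μ N k) i (N + M) = List.range' i (N + 1 - i) ++ l.map (· + N) ++
        List.range' (N + μ.length + 1) 0 := by
      rw [hs1, hcons]
      simp
    rw [hE] at hn1 ⊢
    have := coeff_hatDExt na (k := k) (ω := omegaCycle 1 M) hM'.2 (Or.inl rfl)
      (fun x => omegaCycle_apply_of_lt) (fun x => omegaCycle_le_iff) hl (by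
        intro x hx
        rw [List.mem_range'_1] at hx
        omega) hn1 (by
        rw [List.length_range']
        omega)
    rw [List.length_range'] at this
    rw [hL, this]
  -- After rotation the cut point `N + M` joins `1, …, i - 1` in the initial block, which makes its
  -- length `i`.
  · have hrot2 : strand (paddedLoop μ N k) (N + M) i ~r (List.range' 1 (i - 1) ++ [N + M]) ++
        r.map (· + N) ++ List.range' (N + μ.length + 1) k := by
      rw [hs2, ← List.cons_append]
      refine List.isRotated_append.trans (isRotated_of_eq ?_)
      simp
    rw [lowDeriv_congr na hn2 hrot2]
    have := coeff_hatDExt na (k := k) (ω := omegaCycle 1 M) hM'.2 (Or.inr rfl)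
      (fun x => omegaCycle_apply_of_lt) (fun x => omegaCycle_le_iff) hr (by
        intro x hx
        rw [List.mem_append, List.mem_range'_1, List.mem_singleton] at hx
        omega) (hrot2.nodup_iff.mp hn2) (by simp)
    rw [List.length_append, List.length_range', List.length_singleton,
      show i - 1 + 1 = i by omega] at this
    rw [hR, this]

/-- The two loops obtained by cutting at two points of the deformation. -/
theorem lowDeriv_cut_inside {m M : ℕ} {α β γ : List ℕ} {x y : ℕ}
    (hxy : μ = α ++ x :: β ++ y :: γ) (hM : M ∈ μ) (hx : x ≤ M) (hy : y ≤ M) :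
    rename (fun j => N + k + μ.length - j)
        (lowDeriv na (strand (paddedLoop μ N k) (N + x) (N + y)) (N + M + 1)) =
      PowerSeries.coeff 0 (hatDExt na μ.length M k ((x :: β).map (omegaCycle (m + 1) M)) 0) ∧
    rename (fun j => N + k + μ.length - j)
        (lowDeriv na (strand (paddedLoop μ N k) (N + y) (N + x)) (N + M + 1)) =
      PowerSeries.coeff N
        (hatDExt na μ.length M k ((α ++ y :: γ).map (omegaCycle (m + 1) M)) k) := by
  have hM' := (mem_deformation hμ).mp hM
  have hxm := (mem_deformation hμ).mp (show x ∈ μ by simp [hxy])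
  have hym := (mem_deformation hμ).mp (show y ∈ μ by simp [hxy])
  have hne : x ≠ y := by
    rintro rfl
    have := hμ.nodup
    rw [hxy] at this
    exact List.disjoint_of_nodup_append this (a := x) (by simp) (by simp)
  have h1 : ∀ z ∈ x :: β, z ≤ μ.length := hμ.le_length fun z hz => by
    rw [hxy]
    exact List.mem_append_left _ (List.mem_append_right _ hz)
  have h2 : ∀ z ∈ α ++ y :: γ, z ≤ μ.length := hμ.le_length fun z hz => by
    rw [hxy]
    simp only [List.mem_append, List.mem_cons] at hz ⊢
    tauto
  have hw := paddedLoop_nodup hμ N k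
  have hmx : N + x ∈ paddedLoop μ N k := (mem_paddedLoop hμ).mpr (by omega)
  have hmy : N + y ∈ paddedLoop μ N k := (mem_paddedLoop hμ).mpr (by omega)
  have hrot : paddedLoop μ N k ~r ((N + x) :: β.map (· + N)) ++ (N + y) :: (γ.map (· + N) ++
      List.range' (N + μ.length + 1) k ++ (List.range' 1 N ++ α.map (· + N))) := by
    have h3 : paddedLoop μ N k = (List.range' 1 N ++ α.map (· + N)) ++
        (((N + x) :: β.map (· + N)) ++ (N + y) :: (γ.map (· + N) ++
          List.range' (N + μ.length + 1) k)) := by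
      rw [paddedLoop]
      conv_lhs => rw [show List.map (· + N) μ = α.map (· + N) ++ (x + N) :: β.map (· + N) ++
        (y + N) :: γ.map (· + N) by simp [hxy]]
      simp [add_comm N]
    rw [h3]
    refine List.isRotated_append.trans (isRotated_of_eq ?_)
    simp
  have hs1 := strand_of_isRotated hw hrot
  have hs2 := strand_of_isRotated hw (hrot.trans List.isRotated_append)
  have hn1 := strand_nodup hw hmx hmy (by omega)
  have hn2 := strand_nodup hw hmy hmx (by omega)
  constructor
  · have hE : strand (paddedLoop μ N k) (N + x) (N + y) = [] ++ (x :: β).map (· + N) ++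
        List.range' (N + μ.length + 1) 0 := by
      rw [hs1]
      simp [add_comm N]
    rw [hE] at hn1 ⊢
    exact (coeff_hatDExt na (k := k) (ω := omegaCycle (m + 1) M) hM'.2 (Or.inl rfl)
      (fun x => omegaCycle_apply_of_lt) (fun x => omegaCycle_le_iff) h1 (by simp) hn1
      (by simp)).symm
  · have hrot2 : strand (paddedLoop μ N k) (N + y) (N + x) ~r List.range' 1 N ++
        (α ++ y :: γ).map (· + N) ++ List.range' (N + μ.length + 1) k := by
      rw [hs2, ← List.cons_append, ← List.cons_append]
      refine List.isRotated_append.trans (isRotated_of_eq ?_)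
      simp [add_comm N]
    rw [lowDeriv_congr na hn2 hrot2]
    have := coeff_hatDExt na (k := k) (ω := omegaCycle (m + 1) M) hM'.2 (Or.inr rfl)
      (fun x => omegaCycle_apply_of_lt) (fun x => omegaCycle_le_iff) h2 (by
        intro x hx
        rw [List.mem_range'_1] at hx
        omega) (hrot2.nodup_iff.mp hn2) (by simp)
    rw [List.length_range'] at this
    rw [this]

omit hμ in
theorem ext_of_eq {m M : ℕ} {α β γ : List ℕ} {x y : ℕ} (hn : μ.Nodup)
    (hxy : μ = α ++ x :: β ++ y :: γ) (h : x = m ∧ y = M ∨ x = M ∧ y = m) :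
    extBetween μ m M = (x :: β).map (omegaCycle (m + 1) M) ∧
      extOutside μ m M = (α ++ y :: γ).map (omegaCycle (m + 1) M) := by
  have hn' := hn
  rw [hxy] at hn'
  have hix : μ.idxOf x = α.length := by
    rw [hxy, List.append_assoc, List.idxOf_append_of_notMem, List.cons_append,
      List.idxOf_cons_self, add_zero]
    intro h
    exact List.disjoint_of_nodup_append hn'.of_append_left h (by simp)
  have hiy : μ.idxOf y = (α ++ x :: β).length := by
    rw [hxy, List.idxOf_append_of_notMem, List.idxOf_cons_self, add_zero]
    intro h
    exact List.disjoint_of_nodup_append hn' h (by simp)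
  have hle : α.length ≤ (α ++ x :: β).length := by simp
  have hmin : min (μ.idxOf m) (μ.idxOf M) = α.length := by
    rcases h with ⟨rfl, rfl⟩ | ⟨rfl, rfl⟩
    · rw [hix, hiy, min_eq_left hle]
    · rw [hix, hiy, min_eq_right hle]
  have hmax : max (μ.idxOf m) (μ.idxOf M) = (α ++ x :: β).length := by
    rcases h with ⟨rfl, rfl⟩ | ⟨rfl, rfl⟩
    · rw [hix, hiy, max_eq_right hle]
    · rw [hix, hiy, max_eq_left hle]
  rw [extBetween, extOutside, hmin, hmax]
  have hd : μ.drop (α ++ x :: β).length = y :: γ := by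
    rw [hxy, List.drop_left]
  have hd' : μ.drop α.length = x :: β ++ y :: γ := by
    rw [hxy, List.append_assoc, List.drop_left]
  have ht : μ.take α.length = α := by
    rw [hxy, List.append_assoc, List.take_left]
  rw [hd, hd', ht, show (α ++ x :: β).length - α.length = (x :: β).length by simp, List.take_left]
  exact ⟨rfl, rfl⟩

theorem exists_ext_eq {m M : ℕ} (hm : m ∈ μ) (hM : M ∈ μ) (hmM : m ≠ M) :
    ∃ α β γ x y, μ = α ++ x :: β ++ y :: γ ∧ (x = m ∧ y = M ∨ x = M ∧ y = m) := by
  have hn := hμ.nodup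
  obtain ⟨l, r, hlr⟩ := List.append_of_mem hM
  have h : m ∈ l ∨ m ∈ r := by
    rw [hlr] at hm
    simp only [List.mem_append, List.mem_cons] at hm
    tauto
  rcases h with h | h
  · obtain ⟨α, β, rfl⟩ := List.append_of_mem h
    exact ⟨α, β, r, m, M, hlr, Or.inl ⟨rfl, rfl⟩⟩
  · obtain ⟨β, γ, rfl⟩ := List.append_of_mem h
    exact ⟨l, β, γ, M, m, by simp [hlr], Or.inr ⟨rfl, rfl⟩⟩

/-- The cuts below `N + M` are at the initial points `i ≤ N` or at the points `N + m` of the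
deformation with `m < M`. -/
theorem rename_holeAt_paddedLoop {M : ℕ} (hM : M ∈ μ) :
    rename (fun j => N + k + μ.length - j) (holeAt na (paddedLoop μ N k) (N + M)) =
      ∑ i ∈ Finset.Icc 1 N,
        PowerSeries.coeff (N + 1 - i) (hatDExt na μ.length M k (extLeft μ M) 0) *
          PowerSeries.coeff i (hatDExt na μ.length M k (extRight μ M) k) +
      ∑ m ∈ Finset.Icc 1 (M - 1),
        PowerSeries.coeff 0 (hatDExt na μ.length M k (extBetween μ m M) 0) *
          PowerSeries.coeff N (hatDExt na μ.length M k (extOutside μ m M) k) := by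
  have hM' := (mem_deformation hμ).mp hM
  have hfil : (paddedLoop μ N k).toFinset.filter (· < N + M) = Finset.Ico 1 (N + M) := by
    ext x
    rw [Finset.mem_filter, List.mem_toFinset, mem_paddedLoop hμ, Finset.mem_Ico]
    omega
  rw [holeAt, hfil, ← Finset.sum_Ico_consecutive _ (show 1 ≤ N + 1 by omega)
    (show N + 1 ≤ N + M by omega), map_add, map_sum, map_sum]
  refine congrArg₂ (· + ·) ?_ ?_
  · rw [show Finset.Ico 1 (N + 1) = Finset.Icc 1 N by
      ext
      simp only [Finset.mem_Ico, Finset.mem_Icc]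
      omega]
    refine Finset.sum_congr rfl fun i hi => ?_
    rw [Finset.mem_Icc] at hi
    obtain ⟨l, r, hlr⟩ := List.append_of_mem hM
    obtain ⟨h1, h2⟩ := lowDeriv_cut_before na hμ N k hlr hi.1 hi.2
    rw [map_mul, h1, h2]
  · rw [show N + 1 = 1 + N by ring, show N + M = M + N by ring, ← Finset.sum_Ico_add']
    rw [show Finset.Ico 1 M = Finset.Icc 1 (M - 1) by
      ext
      simp only [Finset.mem_Ico, Finset.mem_Icc]
      omega]
    refine Finset.sum_congr rfl fun m hm => ?_
    rw [Finset.mem_Icc] at hm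
    have hm' : m ∈ μ := (mem_deformation hμ).mpr (by omega)
    obtain ⟨α, β, γ, x, y, hxy, h⟩ := exists_ext_eq hμ hm' hM (by omega)
    obtain ⟨hb, ho⟩ := ext_of_eq hμ.nodup hxy h
    obtain ⟨h1, h2⟩ := lowDeriv_cut_inside na hμ N k (m := m) hxy hM
      (by rcases h with h | h <;> omega) (by rcases h with h | h <;> omega)
    rw [map_mul, hb, ho, ← h1, ← h2, add_comm m N, add_comm M N]
    -- Whether `m` or `M` comes first in `μ` only decides which factor is the inner strand.
    rcases h with ⟨rfl, rfl⟩ | ⟨rfl, rfl⟩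
    · rfl
    · exact mul_comm _ _

/-! ### Counting the floating points of the extractions -/

theorem length_filter_deformation {M : ℕ} (hM : M ≤ μ.length) :
    (μ.filter (M < ·)).length = μ.length - M := by
  have h : (μ.filter (M < ·)).Perm (List.range' (M + 1) (μ.length - M)) := by
    refine (List.perm_ext_iff_of_nodup (hμ.nodup.filter _) List.nodup_range').mpr fun x => ?_
    rw [List.mem_filter, mem_deformation hμ, List.mem_range'_1, decide_eq_true_eq]
    omega
  rw [h.length_eq, List.length_range']

theorem length_floating_right_add_left {M : ℕ} (hM : M ∈ μ) :
    (floating (extRight μ M) M μ.length).length + (floating (extLeft μ M) M μ.length).length =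
      μ.length - M := by
  rw [extRight, extLeft, length_floating_map, length_floating_map,
    ← length_filter_deformation hμ ((mem_deformation hμ).mp hM).2]
  · have h := List.take_append_drop (μ.idxOf M) μ
    rw [List.drop_eq_getElem_cons (List.idxOf_lt_length_of_mem hM), List.getElem_idxOf] at h
    conv_rhs => rw [← h, List.filter_append, List.filter_cons_of_neg (by simp)]
    rw [List.length_append, add_comm]
  · exact hμ.le_length fun x hx => List.mem_of_mem_take hx
  · exact hμ.le_length fun x hx => List.mem_of_mem_drop hx

theorem length_floating_outside_add_between {m M : ℕ} (hm : m ∈ μ) (hM : M ∈ μ) (hmM : m ≠ M) :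
    (floating (extOutside μ m M) M μ.length).length +
      (floating (extBetween μ m M) M μ.length).length = μ.length - M := by
  obtain ⟨α, β, γ, x, y, hxy, h⟩ := exists_ext_eq hμ hm hM hmM
  obtain ⟨hb, ho⟩ := ext_of_eq hμ.nodup hxy h
  have hp : ((α ++ y :: γ) ++ x :: β).Perm μ := by
    rw [hxy, List.append_assoc, List.append_assoc]
    exact List.perm_append_comm.append_left _
  rw [hb, ho, length_floating_map, length_floating_map,
    ← length_filter_deformation hμ ((mem_deformation hμ).mp hM).2, ← (hp.filter _).length_eq,
    ← List.length_append, ← List.filter_append]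
  · exact hμ.le_length fun x hx => hp.mem_iff.mp (List.mem_append_right _ hx)
  · exact hμ.le_length fun x hx => hp.mem_iff.mp (List.mem_append_left _ hx)

/-- Along the points up to the end of the deformation, the deformation is invisible. -/
theorem lowDeriv_paddedLoop (h0 : 0 < N + k + μ.length) :
    lowDeriv na (paddedLoop μ N k) (N + μ.length + 1) =
      lowDeriv na (List.range' 1 (N + k + μ.length)) (N + μ.length + 1) := by
  have hlen := length_paddedLoop μ N k
  -- The padded loop is the regular loop relabelled by sending a position to the label found there;
  -- this fixes everything after the deformation.
  have hmap : (List.range' 1 (N + k + μ.length)).map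
      (fun x => (paddedLoop μ N k).getD (x - 1) 0) = paddedLoop μ N k := by
    refine List.ext_getElem (by simp [hlen]) fun i h1 h2 => ?_
    rw [List.getElem_map, List.getElem_range', show 1 + 1 * i - 1 = i by omega,
      List.getD_eq_getElem]
  have hhi : ∀ x, N + μ.length + 1 ≤ x → x ≤ N + k + μ.length →
      (paddedLoop μ N k).getD (x - 1) 0 = x := by
    intro x h1 h2
    rw [paddedLoop, List.getD_append_right _ _ _ _ (by simp; omega), List.getD_eq_getElem _ _
      (by simp; omega), List.getElem_range']
    simp
    omega
  have hlo : ∀ x, 1 ≤ x → x ≤ N + μ.length →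
      (paddedLoop μ N k).getD (x - 1) 0 < N + μ.length + 1 := by
    intro x h1 h2
    have h3 : x - 1 < (List.range' 1 N ++ μ.map (· + N)).length := by
      simp
      omega
    rw [paddedLoop, List.getD_append _ _ _ _ h3, List.getD_eq_getElem _ _ h3]
    have h4 := List.getElem_mem h3
    rw [List.mem_append, List.mem_range'_1, List.mem_map] at h4
    rcases h4 with h4 | ⟨y, hy, h4⟩
    · omega
    · have := (mem_deformation hμ).mp hy
      omega
  have hMA := (loopValue_multiAffine na (List.nodup_range' (s := 1) (n := N + k + μ.length))
    (by simpa using h0)).lowDeriv (N + μ.length + 1)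
  have h := lowDeriv_map na (w := List.range' 1 (N + k + μ.length))
    (g := fun x => (paddedLoop μ N k).getD (x - 1) 0) (c := N + μ.length + 1)
    (c' := N + μ.length + 1) (by rw [hmap]; exact paddedLoop_nodup hμ N k) (by simpa using h0)
    (by
      intro x hx
      rw [List.mem_range'_1] at hx
      by_cases hx' : x ≤ N + μ.length
      · have := hlo x hx.1 hx'
        omega
      · rw [hhi x (by omega) (by omega)])
    (by
      intro x hx y hy h1 h2
      rw [List.mem_range'_1] at hx hy
      rwa [hhi x h1 (by omega), hhi y (by omega) (by omega)])
  rw [hmap] at h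
  rw [h]
  refine hMA.rename_eq_self fun x hx => ?_
  rw [Finset.mem_filter, List.mem_toFinset, List.mem_range'_1] at hx
  exact hhi x hx.2 (by omega)

/-! ### The identities for the generating functions -/

theorem mem_of_eq_sub {p M : ℕ} (hp : p < μ.length) (hM : M = μ.length - p) : M ∈ μ :=
  (mem_deformation hμ).mpr (by omega)

/-- The coefficients of `Ŝ`; the convention for `N = 0` agrees with the empty sum over the cuts. -/
theorem coeff_hatS {p M : ℕ} (hp : p < μ.length) (hM : M = μ.length - p) :
    PowerSeries.coeff N (hatS na μ k p) =
      rename (fun j => N + k + μ.length - j) (holeAt na (paddedLoop μ N k) (N + M)) := by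
  rw [hatS, PowerSeries.coeff_mk]
  split_ifs with h
  · rw [holeAt, Finset.filter_false_of_mem, Finset.sum_empty, map_zero]
    intro x hx
    rw [List.mem_toFinset, mem_paddedLoop hμ] at hx
    omega
  · exact coefS_eq_holeAt na hμ hp hM (by omega)

theorem hatD_succ {p : ℕ} (hp : p < μ.length) :
    hatD na μ k (p + 1) = hatS na μ k p + PowerSeries.C (X (k + p)) * hatD na μ k p +
      PowerSeries.C (C (if k = 0 ∧ μ.length = 1 then na else 0)) := by
  ext1 N
  have hw := paddedLoop_nodup hμ N k
  have hlen := length_paddedLoop μ N k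
  have hM : N + (μ.length - p) ∈ paddedLoop μ N k := (mem_paddedLoop hμ).mpr (by omega)
  rw [map_add, map_add, PowerSeries.coeff_C_mul, PowerSeries.coeff_C, coeff_hatS na hμ N k hp rfl,
    coeff_hatD na hμ (by omega), coeff_hatD na hμ (by omega),
    show N + μ.length - (p + 1) + 1 = N + (μ.length - p) by omega,
    show N + μ.length - p + 1 = N + (μ.length - p) + 1 by omega]
  have hX : rename (fun j => N + k + μ.length - j) (X (N + (μ.length - p)) : MvPolynomial ℕ ℝ) =
      X (k + p) := by
    rw [rename_X]
    congr 1
    omega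
  by_cases h2 : 2 ≤ N + k + μ.length
  · rw [lowDeriv_eq_holeAt_add na hw (by omega) hM, map_add, map_mul, hX]
    split_ifs
    · omega
    · simp
    · simp
  -- Only the one-point loop escapes the recursion: its value at zero is `na`, whereas `holeAt`
  -- vanishes.
  · obtain rfl : N = 0 := by omega
    obtain ⟨i, hi⟩ := List.length_eq_one_iff.mp (show (paddedLoop μ 0 k).length = 1 by omega)
    rw [hi, List.mem_singleton] at hM
    rw [if_pos rfl, if_pos ⟨by omega, by omega⟩, ← hX, ← map_mul, ← rename_C
      (fun j => 0 + k + μ.length - j) na, ← map_add, ← map_add, hi, hM]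
    simp [lowDeriv, loopValue_singleton, holeAt, Finset.filter_singleton, add_comm]

theorem hatS_eq {p M : ℕ} (hp : p < μ.length) (hM : M = μ.length - p) :
    hatS na μ k p = PowerSeries.mk (fun N => ∑ i ∈ Finset.Icc 1 N,
        PowerSeries.coeff (N + 1 - i) (hatDExt na μ.length M k (extLeft μ M) 0) *
          PowerSeries.coeff i (hatDExt na μ.length M k (extRight μ M) k)) +
      ∑ m ∈ Finset.Icc 1 (M - 1), PowerSeries.C (PowerSeries.constantCoeff
          (hatDExt na μ.length M k (extBetween μ m M) 0)) *
        hatDExt na μ.length M k (extOutside μ m M) k := by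
  ext1 N
  rw [coeff_hatS na hμ N k hp hM, rename_holeAt_paddedLoop na hμ N k (mem_of_eq_sub hμ hp hM),
    map_add, PowerSeries.coeff_mk, map_sum]
  simp only [PowerSeries.coeff_C_mul, PowerSeries.coeff_zero_eq_constantCoeff_apply]

end

/-! ### Passage to Laurent series -/

theorem zPow_mul_subConst (F : PowerSeries (MvPolynomial ℕ ℝ)) :
    zPow (-1) * (subConst F : LaurentSeries (MvPolynomial ℕ ℝ)) =
      (PowerSeries.mk fun n => PowerSeries.coeff (n + 1) F :
        PowerSeries (MvPolynomial ℕ ℝ)) := by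
  have h : subConst F = PowerSeries.X * PowerSeries.mk fun n => PowerSeries.coeff (n + 1) F := by
    rw [subConst]
    conv_lhs => rw [PowerSeries.eq_X_mul_shift_add_const F]
    simp
  rw [h, PowerSeries.coe_mul, PowerSeries.coe_X, ← mul_assoc, zPow, HahnSeries.single_mul_single]
  simp

theorem zPow_mul_subConst_mul_subConst (F G : PowerSeries (MvPolynomial ℕ ℝ)) :
    zPow (-1) * (subConst F : LaurentSeries (MvPolynomial ℕ ℝ)) * (subConst G : PowerSeries _) =
      (PowerSeries.mk fun N => ∑ i ∈ Finset.Icc 1 N,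
        PowerSeries.coeff (N + 1 - i) F * PowerSeries.coeff i G :
        PowerSeries (MvPolynomial ℕ ℝ)) := by
  rw [zPow_mul_subConst, ← PowerSeries.coe_mul]
  congr 1
  ext1 N
  rw [mul_comm, PowerSeries.coeff_mul, PowerSeries.coeff_mk,
    Finset.Nat.sum_antidiagonal_eq_sum_range_succ fun i j => PowerSeries.coeff i (subConst G) *
      PowerSeries.coeff j (PowerSeries.mk fun n => PowerSeries.coeff (n + 1) F)]
  symm
  -- Only `i = 0` is dropped from the Cauchy product: that term contains the constant coefficient of
  -- `subConst G`, which is zero.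
  apply Finset.sum_subset_zero_on_sdiff
  · intro i hi
    rw [Finset.mem_Icc] at hi
    rw [Finset.mem_range]
    omega
  · intro i hi
    rw [Finset.mem_sdiff, Finset.mem_Icc, Finset.mem_range] at hi
    obtain rfl : i = 0 := by omega
    simp [subConst]
  · intro i hi
    rw [Finset.mem_Icc] at hi
    rw [PowerSeries.coeff_mk, subConst, map_sub, PowerSeries.coeff_C, if_neg (by omega), sub_zero,
      mul_comm, show N - i + 1 = N + 1 - i by omega]

/-- Every point of the deformation is differentiated, so the padded loop may be replaced by the
regular one; the exponent `1 - μ.length` matches `N + μ.length` derivatives on the left with one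
more than the index on the right. -/
theorem hatD_zero (na : ℝ) {μ : List ℕ} (hμ : IsDeformation μ) (h1 : 1 ≤ μ.length) (k : ℕ) :
    hatD na μ k 0 = laurentPos (zPow (1 - (μ.length : ℤ)) *
      (genC na k : LaurentSeries (MvPolynomial ℕ ℝ))) := by
  ext1 N
  rw [coeff_hatD na hμ (Nat.zero_le _), laurentPos, PowerSeries.coeff_mk, zPow,
    show (N : ℤ) = ((N + μ.length - 1 : ℕ) : ℤ) + (1 - (μ.length : ℤ)) by omega,
    HahnSeries.coeff_single_mul_add, one_mul, LaurentSeries.coeff_coe_powerSeries, genC,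
    PowerSeries.coeff_mk, derivs_range'_eq_lowDeriv na (List.Perm.refl _) (by omega),
    show N + μ.length - 1 + k + 1 = N + k + μ.length by omega,
    show N + μ.length - 1 + 1 + 1 = N + μ.length + 1 by omega, Nat.sub_zero,
    lowDeriv_paddedLoop na hμ N k (by omega)]

end QSSEP

theorem mainTheorem8 (na : ℝ) :
    -- the loop values are the only possible solution of the stationarity conditions
    (∀ E : Cycle ℕ → MvPolynomial ℕ ℝ, QSSEP.IsStationary na E →
      ∀ w : List ℕ, w ≠ [] → w.Nodup → E (w : Cycle ℕ) = QSSEP.loopValue na w) ∧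
    ∀ μ : List ℕ, QSSEP.IsDeformation μ → 1 ≤ μ.length →
      -- the recursion inside the support of the deformation
      (∀ k' p' M : ℕ, p' < μ.length → M = μ.length - p' →
        (QSSEP.hatD na μ k' (p' + 1) =
          QSSEP.hatS na μ k' p'
            + PowerSeries.C (MvPolynomial.X (k' + p')) * QSSEP.hatD na μ k' p'
            + PowerSeries.C (MvPolynomial.C (if k' = 0 ∧ μ.length = 1 then na else 0))) ∧
        ((QSSEP.hatS na μ k' p' : LaurentSeries (MvPolynomial ℕ ℝ)) =
          QSSEP.zPow (-1)
              * (QSSEP.subConst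
                  (QSSEP.hatDExt na μ.length M k' (QSSEP.extLeft μ M) 0) :
                    PowerSeries (MvPolynomial ℕ ℝ))
              * (QSSEP.subConst
                  (QSSEP.hatDExt na μ.length M k' (QSSEP.extRight μ M) k') :
                    PowerSeries (MvPolynomial ℕ ℝ))
            + ∑ m ∈ Finset.Icc 1 (M - 1),
                ((PowerSeries.C (PowerSeries.constantCoeff
                    (QSSEP.hatDExt na μ.length M k' (QSSEP.extBetween μ m M) 0))
                  * QSSEP.hatDExt na μ.length M k' (QSSEP.extOutside μ m M) k' :
                    PowerSeries (MvPolynomial ℕ ℝ)) : LaurentSeries (MvPolynomial ℕ ℝ))) ∧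
        (QSSEP.floating (QSSEP.extRight μ M) M μ.length).length
          + (QSSEP.floating (QSSEP.extLeft μ M) M μ.length).length = p' ∧
        ∀ m ∈ Finset.Icc 1 (M - 1),
          (QSSEP.floating (QSSEP.extOutside μ m M) M μ.length).length
            + (QSSEP.floating (QSSEP.extBetween μ m M) M μ.length).length = p') ∧
      -- the initial condition
      (∀ k' : ℕ, QSSEP.hatD na μ k' 0 =
        QSSEP.laurentPos (QSSEP.zPow (1 - (μ.length : ℤ))
          * (QSSEP.genC na k' : LaurentSeries (MvPolynomial ℕ ℝ)))) ∧
      -- the resulting initial data, at `q = 1`, of the recursion outside the deformation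
      (∀ k : ℕ,
        QSSEP.genD na μ 1 (k + μ.length) = QSSEP.hatD na μ (k + 1) (μ.length - 1) ∧
        (QSSEP.genS na μ 1 (k + μ.length) : LaurentSeries (MvPolynomial ℕ ℝ)) =
          QSSEP.zPow (-1) * (QSSEP.subConst (QSSEP.hatS na μ (k + 1) (μ.length - 1)) :
            PowerSeries (MvPolynomial ℕ ℝ))) := by
  refine ⟨fun E hE w hw hn => hE.eq_loopValue hn (List.length_pos_iff.mpr hw),
    fun μ hμ h1 => ⟨fun k' p' M hp hM => ⟨QSSEP.hatD_succ na hμ k' hp, ?_, ?_, fun m hm => ?_⟩,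
      QSSEP.hatD_zero na hμ h1, fun k => ⟨?_, ?_⟩⟩⟩
  · rw [QSSEP.hatS_eq na hμ k' hp hM, QSSEP.zPow_mul_subConst_mul_subConst, PowerSeries.coe_add]
    congr 1
    exact map_sum (HahnSeries.ofPowerSeries ℤ (MvPolynomial ℕ ℝ)) _ _
  · rw [QSSEP.length_floating_right_add_left hμ (QSSEP.mem_of_eq_sub hμ hp hM)]
    omega
  · rw [Finset.mem_Icc] at hm
    rw [QSSEP.length_floating_outside_add_between hμ
      ((QSSEP.mem_deformation hμ).mpr (by omega)) (QSSEP.mem_of_eq_sub hμ hp hM) (by omega)]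
    omega
  · ext1 N
    rw [QSSEP.genD, QSSEP.hatD, PowerSeries.coeff_mk, PowerSeries.coeff_mk, add_comm 1 N]
    congr 1 <;> omega
  · rw [QSSEP.zPow_mul_subConst]
    congr 1
    ext1 N
    -- The coefficient of `hatS` compared here has index `N + 1`, so the convention at index zero
    -- does not intervene.
    rw [QSSEP.genS, QSSEP.hatS, PowerSeries.coeff_mk, PowerSeries.coeff_mk,
      PowerSeries.coeff_mk, if_neg (by omega), add_comm 1 N]
    congr 1 <;> omega
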